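/- Let $K_2,L,T>0$ and $1<\beta<2$. For integers $M,N\ge 1$ put $h=L/M$, $\tau=T/N$, $x_i=ih$, $t_n=n\tau$. For $K_1>0$ and $0<\alpha<1$ put $$a_n^{(\alpha)}=\frac{(n+1)^{1-\alpha}-n^{1-\alpha}}{\Gamma(2-\alpha)},\qquad b_n^{(\beta)}=a_n^{(\beta-1)}\qquad(n\ge 0),$$ $$\delta_t^{\alpha}v^n=\frac1{\tau^\alpha}\Big[a_0^{(\alpha)}v^n-\sum_{k=1}^{n-1}\big(a_{n-k-1}^{(\alpha)}-a_{n-k}^{(\alpha)}\big)v^k-a_{n-1}^{(\alpha)}v^0\Big],$$ $$\Delta_t^{\beta}v^n=\frac1{\tau^\beta}\Big[\sum_{k=2}^{n}b_{n-k}^{(\beta)}(v^k-2v^{k-1}+v^{k-2})+2b_{n-1}^{(\beta)}(v^1-v^0)\Big],$$ $$\delta_x^2v_i=\frac{v_{i+1}-2v_i+v_{i-1}}{h^2},\qquad \mathcal A_xv_i=\tfrac1{12}(v_{i-1}+10v_i+v_{i+1})\qquad(1\le i\le M-1).$$ Consider the compact difference scheme for $K_1\,{}_0^CD_t^\alpha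 u+K_2\,{}_0^CD_t^\beta u=\partial_x^2u+f$ on $(0,L)\times(0,T]$ with initial data $u(\cdot,0)=\phi_0$, $u_t(\cdot,0)=\phi_1$ and boundary data $u(0,\cdot)=g_0$, $u(L,\cdot)=g_1$: $$K_1\mathcal A_x\delta_t^\alpha u_i^n+K_2\mathcal A_x\Delta_t^\beta u_i^n=\delta_x^2u_i^n+\mathcal A_xf(x_i,t_n)+\frac{2K_2b_{n-1}^{(\beta)}}{\tau^{\beta-1}}\mathcal A_x\phi_1(x_i),\quad 1\le i\le M-1,\ 1\le n\le N,$$ $$u_i^0=\phi_0(x_i)\ (0\le i\le M),\qquad u_0^n=g_0(t_n),\quad u_M^n=g_1(t_n)\ (1\le n\le N).$$ For grid functions let $\|v\|^2=h\sum_{i=0}^{M}v_i^2$, $|v|_1^2=h\sum_{i=1}^{M}\big(\tfrac{v_i-v_{i-1}}h\big)^2$ and $\|v\|_\infty=\max_{0\le i\le M}|v_i|$. The scheme is unconditionally stable with respect to the initial data and the right-hand side, in the following sense. There is a constant $C>0$ depending only on $K_2,\beta,L,T$ such that for all $K_1>0$, $0<\alpha<1$, all $M,N\ge 1$ (with no relation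 between $h$ and $\tau$), and any two solutions $u,\tilde u$ of the scheme with the same boundary data $g_0,g_1$ and with data $(\phi_0,\phi_1,f)$ and $(\tilde\phi_0,\tilde\phi_1,\tilde f)$ respectively, the following holds for every $0\le m\le N$. Put $$R_m=\|\phi_1-\tilde\phi_1\|^2+\tau^{\beta-1}\|f(\cdot,t_1)-\tilde f(\cdot,t_1)\|^2+\tau\sum_{n=1}^m\|f(\cdot,t_n)-\tilde f(\cdot,t_n)\|^2 .$$ Then $$\|u^m-\tilde u^m\|^2\le C\big(\|\phi_0-\tilde\phi_0\|^2+R_m\big),$$ and, if $\phi_0(0)=\tilde\phi_0(0)$ and $\phi_0(L)=\tilde\phi_0(L)$, also $$|u^m-\tilde u^m|_1^2\le C\big(|\phi_0-\tilde\phi_0|_1^2+R_m\big)\quad\text{and}\quad \|u^m-\tilde u^m\|_\infty^2\le C\big(|\phi_0-\tilde\phi_0|_1^2+R_m\big).$$ -/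

import Mathlib

namespace MixedDiffusionWave

noncomputable section

/-- The coefficients `a_n^{(α)} = ((n+1)^{1-α} - n^{1-α}) / Γ(2-α)`, for `0 < α < 1`
(so that `a_0^{(α)} = 1 / Γ(2-α)`). -/
def aCoeff (α : ℝ) (n : ℕ) : ℝ :=
  (((n : ℝ) + 1) ^ (1 - α) - (n : ℝ) ^ (1 - α)) / Real.Gamma (2 - α)

/-- The coefficients `b_n^{(β)} = a_n^{(β-1)}`, for `1 < β < 2`. -/
def bCoeff (β : ℝ) (n : ℕ) : ℝ := aCoeff (β - 1) n

/-- The L1 difference operator `δ_t^α v^n`, `n ≥ 1`, with time step `τ`. -/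
def deltaAlpha (τ α : ℝ) (v : ℕ → ℝ) (n : ℕ) : ℝ :=
  (aCoeff α 0 * v n
    - ∑ k ∈ Finset.Icc 1 (n - 1), (aCoeff α (n - k - 1) - aCoeff α (n - k)) * v k
    - aCoeff α (n - 1) * v 0) / τ ^ α

/-- The modified L2 difference operator `Δ_t^β v^n`, `n ≥ 1`, with time step `τ`. -/
def DeltaBeta (τ β : ℝ) (v : ℕ → ℝ) (n : ℕ) : ℝ :=
  (∑ k ∈ Finset.Icc 2 n, bCoeff β (n - k) * (v k - 2 * v (k - 1) + v (k - 2))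
    + 2 * bCoeff β (n - 1) * (v 1 - v 0)) / τ ^ β

/-- The second-order central difference quotient `δ_x² v_i`, `1 ≤ i ≤ M - 1`, with mesh size `h`. -/
def deltaXX (h : ℝ) (v : ℕ → ℝ) (i : ℕ) : ℝ :=
  (v (i + 1) - 2 * v i + v (i - 1)) / h ^ 2

/-- The compact averaging operator `𝒜_x` on grid functions on `{0, …, M}`. -/
def avgX (M : ℕ) (v : ℕ → ℝ) (i : ℕ) : ℝ :=
  if i = 0 ∨ i = M then v i else (v (i - 1) + 10 * v i + v (i + 1)) / 12

/-- The discrete `L²` norm `(h ∑_{i=0}^M v_i²)^{1/2}`. For grid functions vanishing at `i = 0, M`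
this is `(h ∑_{i=1}^{M-1} v_i²)^{1/2}`. -/
def l2Norm (h : ℝ) (M : ℕ) (v : ℕ → ℝ) : ℝ :=
  Real.sqrt (h * ∑ i ∈ Finset.range (M + 1), v i ^ 2)

/-- The discrete `H¹` seminorm `|v|_1 = (h ∑_{i=1}^M ((v_i - v_{i-1}) / h)²)^{1/2}`. -/
def h1Norm (h : ℝ) (M : ℕ) (v : ℕ → ℝ) : ℝ :=
  Real.sqrt (h * ∑ i ∈ Finset.Icc 1 M, ((v i - v (i - 1)) / h) ^ 2)

/-- The maximum norm `max_{0 ≤ i ≤ M} |v_i|`. -/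
def maxNorm (M : ℕ) (v : ℕ → ℝ) : ℝ :=
  (Finset.range (M + 1)).sup' Finset.nonempty_range_add_one fun i => |v i|

/-- `u` (with `u i n` the value `u_i^n`) solves the compact difference scheme for
`K₁ D_t^α u + K₂ D_t^β u = ∂_x² u + f` on `(0, L) × (0, T]`, with `u = φ₀`, `u_t = φ₁` at `t = 0`,
`u = g₀` at `x = 0` and `u = g₁` at `x = L`, on the mesh `x_i = i L / M`, `t_n = n T / N`. -/
structure IsSchemeSolution (K₁ K₂ α β L T : ℝ) (M N : ℕ) (φ₀ φ₁ : ℝ → ℝ) (g₀ g₁ : ℝ → ℝ)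
    (f : ℝ → ℝ → ℝ) (u : ℕ → ℕ → ℝ) : Prop where
  equation : ∀ i n : ℕ, 1 ≤ i → i ≤ M - 1 → 1 ≤ n → n ≤ N →
    K₁ * avgX M (fun j => deltaAlpha (T / N) α (u j) n) i
      + K₂ * avgX M (fun j => DeltaBeta (T / N) β (u j) n) i
    = deltaXX (L / M) (fun j => u j n) i
      + avgX M (fun j => f (j * (L / M)) (n * (T / N))) i
      + 2 * K₂ * bCoeff β (n - 1) / (T / N) ^ (β - 1) * avgX M (fun j => φ₁ (j * (L / M))) i
  initial : ∀ i : ℕ, i ≤ M → u i 0 = φ₀ (i * (L / M))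
  boundary_left : ∀ n : ℕ, 1 ≤ n → n ≤ N → u 0 n = g₀ (n * (T / N))
  boundary_right : ∀ n : ℕ, 1 ≤ n → n ≤ N → u M n = g₁ (n * (T / N))

/-- The size of a perturbation `(ψ, F)` of the initial velocity and of the right-hand side:
`‖ψ‖² + τ^{β-1} ‖F^1‖² + τ ∑_{n=1}^m ‖F^n‖²`, where `ψ_i = ψ(x_i)`, `F_i^n = F(x_i, t_n)`,
`h = L / M`, `τ = T / N`. -/
def dataSize (β L T : ℝ) (M N : ℕ) (ψ : ℝ → ℝ) (F : ℝ → ℝ → ℝ) (m : ℕ) : ℝ :=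
  l2Norm (L / M) M (fun i => ψ (i * (L / M))) ^ 2
    + (T / N) ^ (β - 1) * l2Norm (L / M) M (fun i => F (i * (L / M)) (T / N)) ^ 2
    + T / N * ∑ n ∈ Finset.Icc 1 m,
        l2Norm (L / M) M (fun i => F (i * (L / M)) (n * (T / N))) ^ 2

end

end MixedDiffusionWave

/-! By linearity it suffices to bound the difference `W` of two solutions, which satisfies an
equation `A (memory terms of W - data) + Λ W = 0` at each time level, with `A` the compact average
and `Λ` the negative Dirichlet Laplacian on interior points.

Apply an operator `G` to it and test with the increment `W (n+1) - W n`. With `g = h(G A ·, ·)` and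
`a = h(G Λ ·, ·)`, `G = id` makes `a` the squared `H¹` seminorm, while `G = Λ⁻¹` makes it the
squared `L²` norm. Both estimates are thus instances of `energy_estimate`, and the maximum norm
follows from the `H¹` bound by a discrete Sobolev inequality.

In the energy estimate, convexity of the L1 kernel turns the first memory term into increments of a
nonnegative energy (`l1Energy_increment_le`), so `K₁` and `α` leave the bound. Monotonicity of the
second kernel gives an energy controlling the increments of `W` (`l2Energy_increment_le`). The
remaining difficulty is the term `q n • (W 1 - W 0)`. A direct Young estimate would cost the factor
`(∑ q n) / q 0`, which for this kernel is `m ^ (2 - β)`. Instead `W 1 - W 0` is eliminated by the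
first-step equation: this leaves a data vector `y` and a multiple of `a (W 1) (W (n+1) - W n)` with
decreasing weights, which is summed by parts.

The initial difference need not vanish on the boundary. At level `0` the equation sees it only
through its compact average, so it is replaced by the zero-boundary function with the same average
(`avgRep`); data are treated likewise. -/

namespace MixedDiffusionWave

/-! ### Energy method for abstract convolution schemes in a pair of semidefinite forms. -/

section Energy

variable {E : Type*} [AddCommGroup E] [Module ℝ E]

/-- The (unscaled) L1 memory operator with kernel `p`, at time level `n + 1`. -/
def l1Conv (p : ℕ → ℝ) (W : ℕ → E) (n : ℕ) : E :=
  p 0 • W (n + 1) - ∑ k ∈ Finset.range n, (p (n - 1 - k) - p (n - k)) • W (k + 1) - p n • W 0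

/-- The (unscaled) modified L2 memory operator with kernel `q`, at time level `n + 1`, written in
terms of the first differences of `W`. -/
def l2Conv (q : ℕ → ℝ) (W : ℕ → E) (n : ℕ) : E :=
  q 0 • (W (n + 1) - W n)
    - ∑ k ∈ Finset.range n, (q (n - 1 - k) - q (n - k)) • (W (k + 1) - W k)
    + q n • (W 1 - W 0)

lemma sum_kernel_decrements (p : ℕ → ℝ) (n : ℕ) :
    ∑ k ∈ Finset.range n, (p (n - 1 - k) - p (n - k)) = p 0 - p n := by
  rw [← Finset.sum_range_reflect]
  rw [← Finset.sum_range_sub' p n]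
  refine Finset.sum_congr rfl fun k hk => ?_
  have := Finset.mem_range.1 hk
  rw [show n - 1 - (n - 1 - k) = k by omega, show n - (n - 1 - k) = k + 1 by omega]

variable {g : LinearMap.BilinForm ℝ E}

lemma form_sub_self (hs : ∀ x y, g x y = g y x) (x y : E) :
    g (x - y) (x - y) = g x x - 2 * g x y + g y y := by
  simp only [map_sub, LinearMap.sub_apply]
  rw [hs y x]; ring

lemma form_add_self (hs : ∀ x y, g x y = g y x) (x y : E) :
    g (x + y) (x + y) = g x x + 2 * g x y + g y y := by
  simp only [map_add, LinearMap.add_apply]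
  rw [hs y x]; ring

lemma form_le_young (hs : ∀ x y, g x y = g y x) (hg : ∀ x, 0 ≤ g x x) {c : ℝ} (hc : 0 < c)
    (x y : E) : g x y ≤ c / 2 * g y y + g x x / (2 * c) := by
  have h := hg (x - c • y)
  rw [form_sub_self hs] at h
  simp only [map_smul, LinearMap.smul_apply, smul_eq_mul] at h
  have : c / 2 * g y y + g x x / (2 * c) - g x y
      = (g x x - 2 * (c * g x y) + c * (c * g y y)) / (2 * c) := by
    field_simp; ring
  have h2 := div_nonneg h (by positivity : (0 : ℝ) ≤ 2 * c)
  linarith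

lemma form_add_self_le (hs : ∀ x y, g x y = g y x) (hg : ∀ x, 0 ≤ g x x) (x y : E) :
    g (x + y) (x + y) ≤ 2 * g x x + 2 * g y y := by
  have h := hg (x - y)
  rw [form_sub_self hs] at h
  rw [form_add_self hs]; linarith

/-- Polarization: the two sides differ by `g (x - y) (x - y) / 2`. -/
lemma half_sub_le_form (hs : ∀ x y, g x y = g y x) (hg : ∀ x, 0 ≤ g x x) (x y z : E) :
    (g (x - z) (x - z) - g (y - z) (y - z)) / 2 ≤ g (x - y) (x - z) := by
  have h := hg (x - y)
  rw [show y - z = (x - z) - (x - y) by abel, form_sub_self hs (x - z), hs (x - z) (x - y)]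
  linarith

/-- The energy of the L1 memory operator at time level `n`. -/
def l1Energy (g : LinearMap.BilinForm ℝ E) (p : ℕ → ℝ) (W : ℕ → E) (n : ℕ) : ℝ :=
  p (n - 1) * g (W n - W 0) (W n - W 0)
    + ∑ k ∈ Finset.range (n - 1),
        (p (n - 1 - 1 - k) - p (n - 1 - k)) * g (W n - W (k + 1)) (W n - W (k + 1))

lemma l1Energy_nonneg (hg : ∀ x, 0 ≤ g x x) {p : ℕ → ℝ} (hp : ∀ n, 0 ≤ p n)
    (hpa : Antitone p) (W : ℕ → E) (n : ℕ) : 0 ≤ l1Energy g p W n := by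
  refine add_nonneg (mul_nonneg (hp _) (hg _)) (Finset.sum_nonneg fun k hk => ?_)
  exact mul_nonneg (sub_nonneg.2 (hpa (by omega))) (hg _)

/-- The kernel weights sum to zero, so the memory term is a nonnegative combination of the
differences `W (n+1) - W k`, to each of which `half_sub_le_form` applies. This leaves the energy at
level `n` with the weights of level `n + 1`, and convexity says that these weights have only
decreased. -/
lemma l1Energy_increment_le (hs : ∀ x y, g x y = g y x) (hg : ∀ x, 0 ≤ g x x) {p : ℕ → ℝ}
    (hp : ∀ n, 0 ≤ p n) (hpa : Antitone p) (hpc : ∀ n, p (n + 1) - p (n + 2) ≤ p n - p (n + 1))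
    (W : ℕ → E) (n : ℕ) :
    (l1Energy g p W (n + 1) - l1Energy g p W n) / 2 ≤ g (W (n + 1) - W n) (l1Conv p W n) := by
  have hconv : l1Conv p W n = p n • (W (n + 1) - W 0)
      + ∑ k ∈ Finset.range n, (p (n - 1 - k) - p (n - k)) • (W (n + 1) - W (k + 1)) := by
    simp only [l1Conv, smul_sub, Finset.sum_sub_distrib]
    rw [← Finset.sum_smul, sum_kernel_decrements, sub_smul]
    abel
  have hrow : (p n * (g (W (n + 1) - W 0) (W (n + 1) - W 0) - g (W n - W 0) (W n - W 0))
      + ∑ k ∈ Finset.range n, (p (n - 1 - k) - p (n - k)) *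
        (g (W (n + 1) - W (k + 1)) (W (n + 1) - W (k + 1))
          - g (W n - W (k + 1)) (W n - W (k + 1)))) / 2
      ≤ g (W (n + 1) - W n) (l1Conv p W n) := by
    rw [hconv, map_add, map_sum, map_smul, smul_eq_mul, add_div, Finset.sum_div]
    refine add_le_add ?_ (Finset.sum_le_sum fun k hk => ?_)
    · have := mul_le_mul_of_nonneg_left (half_sub_le_form hs hg (W (n + 1)) (W n) (W 0)) (hp n)
      linarith
    · have h0 : 0 ≤ p (n - 1 - k) - p (n - k) := sub_nonneg.2 (hpa (by omega))
      have := mul_le_mul_of_nonneg_left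
        (half_sub_le_form hs hg (W (n + 1)) (W n) (W (k + 1))) h0
      rw [map_smul, smul_eq_mul]
      linarith
  -- The last summand on the left vanishes because it contains `W n - W n`; at `n = 0` everything is
  -- zero.
  have hold : p n * g (W n - W 0) (W n - W 0)
      + ∑ k ∈ Finset.range n, (p (n - 1 - k) - p (n - k)) *
          g (W n - W (k + 1)) (W n - W (k + 1)) ≤ l1Energy g p W n := by
    rcases n with _ | n
    · simp [l1Energy]
    · rw [Finset.sum_range_succ]
      simp only [sub_self, map_zero, mul_zero, add_zero, l1Energy, Nat.add_sub_cancel]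
      refine add_le_add (mul_le_mul_of_nonneg_right (hpa (by omega)) (hg _))
        (Finset.sum_le_sum fun k hk => mul_le_mul_of_nonneg_right ?_ (hg _))
      have hk' := Finset.mem_range.1 hk
      have := hpc (n - 1 - k)
      rwa [show n - 1 - k + 1 = n - k by omega, show n - 1 - k + 2 = n + 1 - k by omega] at this
  have hnew : l1Energy g p W (n + 1) = p n * g (W (n + 1) - W 0) (W (n + 1) - W 0)
      + ∑ k ∈ Finset.range n, (p (n - 1 - k) - p (n - k)) *
        g (W (n + 1) - W (k + 1)) (W (n + 1) - W (k + 1)) := by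
    simp [l1Energy]
  simp only [mul_sub, Finset.sum_sub_distrib] at hrow
  linarith

/-- The energy of the increments of `W` weighted by the kernel `q`. -/
def l2Energy (g : LinearMap.BilinForm ℝ E) (q : ℕ → ℝ) (d : ℕ → E) (n : ℕ) : ℝ :=
  ∑ k ∈ Finset.range n, q (n - 1 - k) * g (d k) (d k)

/-- Young's inequality spends `(q 0 - q n) / 2` of `g (d n) (d n)` on the memory sum and `q n / 2`
on `y`. Exactly half of `q 0 * g (d n) (d n)` survives, which is the new term of the energy. -/
lemma l2Energy_increment_le (hs : ∀ x y, g x y = g y x) (hg : ∀ x, 0 ≤ g x x) {q : ℕ → ℝ}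
    (hq : ∀ n, 0 ≤ q n) (hqa : Antitone q) (d : ℕ → E) (y : E) (n : ℕ) :
    (l2Energy g q d (n + 1) - l2Energy g q d n - q n * g y y) / 2
      ≤ g (q 0 • d n - ∑ k ∈ Finset.range n, (q (n - 1 - k) - q (n - k)) • d k) (d n)
        - q n * g y (d n) := by
  have hyoung : ∀ x z, g x z ≤ (g x x + g z z) / 2 := fun x z => by
    have := form_le_young hs hg one_pos x z
    linarith
  have h1 : ∑ k ∈ Finset.range n, (q (n - 1 - k) - q (n - k)) * g (d k) (d n)
      ≤ ∑ k ∈ Finset.range n, (q (n - 1 - k) - q (n - k)) * ((g (d k) (d k) + g (d n) (d n)) / 2) :=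
    Finset.sum_le_sum fun k hk => mul_le_mul_of_nonneg_left (hyoung _ _)
      (sub_nonneg.2 (hqa (by omega)))
  have h2 : ∑ k ∈ Finset.range n, (q (n - 1 - k) - q (n - k)) *
      ((g (d k) (d k) + g (d n) (d n)) / 2)
      = (∑ k ∈ Finset.range n, q (n - 1 - k) * g (d k) (d k)
        - ∑ k ∈ Finset.range n, q (n - k) * g (d k) (d k) + (q 0 - q n) * g (d n) (d n)) / 2 := by
    rw [← sum_kernel_decrements q n, Finset.sum_mul, ← Finset.sum_sub_distrib,
      ← Finset.sum_add_distrib, Finset.sum_div]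
    exact Finset.sum_congr rfl fun k _ => by ring
  have h3 := mul_le_mul_of_nonneg_left (hyoung y (d n)) (hq n)
  have h4 : l2Energy g q d (n + 1)
      = ∑ k ∈ Finset.range n, q (n - k) * g (d k) (d k) + q 0 * g (d n) (d n) := by
    simp [l2Energy, Finset.sum_range_succ]
  have h5 : g (q 0 • d n - ∑ k ∈ Finset.range n, (q (n - 1 - k) - q (n - k)) • d k) (d n)
      = q 0 * g (d n) (d n)
        - ∑ k ∈ Finset.range n, (q (n - 1 - k) - q (n - k)) * g (d k) (d n) := by
    simp [map_sub, map_sum, LinearMap.sum_apply]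
  rw [h4, h5, l2Energy]
  linarith

/-- Summation by parts against a nonnegative decreasing weight. -/
lemma sum_antitone_mul_sub_le {s z : ℕ → ℝ} (hs : ∀ n, 0 ≤ s n) (hsa : Antitone s)
    (hz0 : z 0 = 0) {Z : ℝ} {m : ℕ} (hz : ∀ n ≤ m, z n ≤ Z) :
    ∑ n ∈ Finset.range m, s n * (z (n + 1) - z n) ≤ s 0 * Z := by
  have hZ : 0 ≤ Z := hz0 ▸ hz 0 (Nat.zero_le _)
  -- At `j = 0` the truncated index gives `s 0`, harmless since `z 0 = 0`.
  have key : ∀ j ≤ m, ∑ n ∈ Finset.range j, s n * (z (n + 1) - z n)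
      ≤ s (j - 1) * z j + (s 0 - s (j - 1)) * Z := by
    intro j
    induction j with
    | zero => intro _; simp [hz0]
    | succ j ih =>
      intro hj
      have h1 := ih (by omega)
      rw [Finset.sum_range_succ, Nat.add_sub_cancel]
      have h2 := mul_le_mul_of_nonneg_left (hz j (by omega))
        (sub_nonneg.2 (hsa (by omega : j - 1 ≤ j)))
      linarith
  have h1 := key m le_rfl
  have h2 := mul_le_mul_of_nonneg_left (hz m le_rfl) (hs (m - 1))
  linarith

variable {a : LinearMap.BilinForm ℝ E}

/-- The first step of the scheme is stable in the form `a`. -/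
lemma first_step_bound (hs : ∀ x y, g x y = g y x) (hg : ∀ x, 0 ≤ g x x)
    (as : ∀ x y, a x y = a y x) (ha : ∀ x, 0 ≤ a x x) {σ q₀ τ : ℝ} (hq₀ : 0 < q₀)
    (hσ : 2 * q₀ ≤ σ) {x₀ x₁ F ψ : E}
    (h : σ * g (x₁ - x₀) (x₁ - x₀) + a x₁ (x₁ - x₀) = g (F + (2 * q₀ * τ) • ψ) (x₁ - x₀)) :
    a x₁ x₁ ≤ a x₀ x₀ + g F F / (2 * q₀) + 2 * q₀ * τ ^ 2 * g ψ ψ := by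
  have hσ0 : 0 < σ := by linarith
  have h1 := half_sub_le_form as ha x₁ x₀ 0
  simp only [sub_zero] at h1
  rw [as (x₁ - x₀)] at h1
  -- The parameter `2 * σ` makes the Young loss equal to `σ * g (x₁ - x₀) (x₁ - x₀)`, so this term
  -- cancels completely.
  have h2 := form_le_young hs hg (by positivity : 0 < 2 * σ) (F + (2 * q₀ * τ) • ψ) (x₁ - x₀)
  have h3 := form_add_self_le hs hg F ((2 * q₀ * τ) • ψ)
  simp only [map_smul, LinearMap.smul_apply, smul_eq_mul] at h3
  have h4 : g (F + (2 * q₀ * τ) • ψ) (F + (2 * q₀ * τ) • ψ) / (2 * (2 * σ))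
      ≤ (2 * g F F + 2 * (2 * q₀ * τ * (2 * q₀ * τ * g ψ ψ))) / (2 * (2 * (2 * q₀))) := by
    refine div_le_div₀ (le_trans (hg _) h3) h3 (by positivity) (by linarith)
  have h5 : (2 * g F F + 2 * (2 * q₀ * τ * (2 * q₀ * τ * g ψ ψ))) / (2 * (2 * (2 * q₀)))
      = (g F F / (2 * q₀) + 2 * q₀ * τ ^ 2 * g ψ ψ) / 2 := by
    field_simp
  linarith

/-- The energy estimate for an abstract scheme with a convex kernel `p` and a decreasing
kernel `q`. -/
theorem energy_estimate (hs : ∀ x y, g x y = g y x) (hg : ∀ x, 0 ≤ g x x)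
    (as : ∀ x y, a x y = a y x) (ha : ∀ x, 0 ≤ a x x) {p q : ℕ → ℝ}
    (hp : ∀ n, 0 ≤ p n) (hpa : Antitone p) (hpc : ∀ n, p (n + 1) - p (n + 2) ≤ p n - p (n + 1))
    (hq : ∀ n, 0 < q n) (hqa : Antitone q) {τ : ℝ} {W F : ℕ → E} {ψ : E} {m : ℕ} (hm : 0 < m)
    (heq : ∀ n < m, ∀ v, g (l1Conv p W n + l2Conv q W n) v + a (W (n + 1)) v
      = g (F n + (2 * q n * τ) • ψ) v) :
    a (W m) (W m) ≤ 6 * a (W 0) (W 0)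
      + 24 * ((∑ n ∈ Finset.range m, q n) * τ ^ 2) * g ψ ψ
      + 3 * ((∑ n ∈ Finset.range m, q n) / q 0 ^ 2) * g (F 0) (F 0)
      + 2 / q (m - 1) * ∑ n ∈ Finset.range m, g (F n) (F n) := by
  set σ : ℝ := p 0 + 2 * q 0 with hσ
  have hq0 := hq 0
  have hσ2 : 2 * q 0 ≤ σ := by have := hp 0; linarith
  have hσ0 : 0 < σ := by linarith
  have hqn : ∀ n, 0 ≤ q n := fun n => (hq n).le
  set Q : ℝ := ∑ n ∈ Finset.range m, q n with hQ
  have hQ0 : q 0 ≤ Q := Finset.single_le_sum (fun i _ => hqn i) (Finset.mem_range.2 hm)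
  -- The part of `2τψ - (W 1 - W 0)` that involves only data, after the first step is solved for `W
  -- 1 - W 0`.
  set y : E := (2 * τ - 2 * q 0 * τ / σ) • ψ - (1 / σ) • F 0 with hy
  have hfirst : ∀ v, σ * g (W 1 - W 0) v + a (W 1) v = g (F 0 + (2 * q 0 * τ) • ψ) v := by
    intro v
    rw [← heq 0 hm v]
    simp only [l1Conv, l2Conv, Finset.range_zero, Finset.sum_empty, sub_zero, zero_add, map_add,
      map_sub, map_smul, LinearMap.add_apply, LinearMap.sub_apply, LinearMap.smul_apply,
      smul_eq_mul, hσ]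
    ring
  have ha1 : a (W 1) (W 1) ≤ a (W 0) (W 0) + g (F 0) (F 0) / (2 * q 0)
      + 2 * q 0 * τ ^ 2 * g ψ ψ :=
    first_step_bound hs hg as ha hq0 hσ2 (hfirst _)
  have hyy : g y y ≤ 8 * τ ^ 2 * g ψ ψ + g (F 0) (F 0) / (2 * q 0 ^ 2) := by
    have h1 := form_add_self_le hs hg ((2 * τ - 2 * q 0 * τ / σ) • ψ) (-((1 / σ) • F 0))
    rw [← sub_eq_add_neg, ← hy] at h1
    simp only [map_neg, LinearMap.neg_apply, map_smul, LinearMap.smul_apply,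
      smul_eq_mul] at h1
    have hr0 : 0 ≤ 2 * q 0 / σ := by positivity
    have hr1 : 2 * q 0 / σ ≤ 1 := (div_le_one hσ0).2 hσ2
    have h2 : (2 * τ - 2 * q 0 * τ / σ) * ((2 * τ - 2 * q 0 * τ / σ) * g ψ ψ)
        ≤ 4 * τ ^ 2 * g ψ ψ := by
      have e : (2 * τ - 2 * q 0 * τ / σ) * ((2 * τ - 2 * q 0 * τ / σ) * g ψ ψ)
        = (2 - 2 * q 0 / σ) ^ 2 * (τ ^ 2 * g ψ ψ) := by ring
      rw [e, mul_assoc]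
      refine mul_le_mul_of_nonneg_right (by nlinarith) (mul_nonneg (sq_nonneg _) (hg _))
    have h3 : 1 / σ * (1 / σ * g (F 0) (F 0)) ≤ g (F 0) (F 0) / (4 * q 0 ^ 2) := by
      have e : 1 / σ * (1 / σ * g (F 0) (F 0)) = g (F 0) (F 0) / σ ^ 2 := by
        field_simp
      rw [e]
      exact div_le_div_of_nonneg_left (hg _) (by positivity) (by nlinarith)
    have e : g (F 0) (F 0) / (2 * q 0 ^ 2) = 2 * (g (F 0) (F 0) / (4 * q 0 ^ 2)) := by
      field_simp; ring
    rw [e]; linarith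
  -- Summing only up to a level where `a (W n) (W n)` is largest lets every occurrence of it on the
  -- right be absorbed on the left.
  obtain ⟨j, hj, hmax⟩ := Finset.exists_max_image (Finset.range (m + 1))
    (fun n => a (W n) (W n)) ⟨0, by simp⟩
  have hjm : j ≤ m := by have := Finset.mem_range.1 hj; omega
  set X : ℝ := a (W j) (W j) with hX
  set s : ℕ → ℝ := fun n => q n / σ with hsdef
  set d : ℕ → E := fun n => W (n + 1) - W n with hd
  have hqj : q (m - 1) ≤ q (j - 1) := hqa (by omega)
  -- The Young weight `q (j - 1)` is the smallest weight in the second energy at level `j`, so that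
  -- energy absorbs the summed increments.
  have hrow : ∀ n < j, (l1Energy g p W (n + 1) - l1Energy g p W n) / 2
      + (l2Energy g q d (n + 1) - l2Energy g q d n) / 2 - q n * g y y / 2
      + (a (W (n + 1)) (W (n + 1)) - a (W n) (W n)) / 2
      ≤ q (j - 1) / 2 * g (d n) (d n) + g (F n) (F n) / (2 * q (j - 1))
        + s n * (a (W 1) (W (n + 1) - W 0) - a (W 1) (W n - W 0)) := by
    intro n hn
    have h1 := l1Energy_increment_le hs hg hp hpa hpc W n
    have h2 := l2Energy_increment_le hs hg hqn hqa d y n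
    have h3 := half_sub_le_form as ha (W (n + 1)) (W n) 0
    simp only [sub_zero] at h3
    rw [as (W (n + 1) - W n)] at h3
    have h4 := form_le_young hs hg (hq (j - 1)) (F n) (d n)
    have h5 := heq n (by omega) (d n)
    have h6 := hfirst (d n)
    have h7 : g (W 1 - W 0) (d n) = (g (F 0 + (2 * q 0 * τ) • ψ) (d n) - a (W 1) (d n)) / σ := by
      rw [← h6]; field_simp; ring
    have h8 : l2Conv q W n = (q 0 • d n
      - ∑ k ∈ Finset.range n, (q (n - 1 - k) - q (n - k)) • d k) + q n • (W 1 - W 0) := rfl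
    rw [h8] at h5
    rw [hs (W (n + 1) - W n)] at h1
    have h9 : g (F n + (2 * q n * τ) • ψ) (d n) - q n * g (W 1 - W 0) (d n)
        = g (F n) (d n) + q n * g y (d n)
          + s n * (a (W 1) (W (n + 1) - W 0) - a (W 1) (W n - W 0)) := by
      rw [← map_sub, sub_sub_sub_cancel_right, h7, hy]
      simp only [map_add, map_sub, map_smul, LinearMap.add_apply, LinearMap.sub_apply,
        LinearMap.smul_apply, smul_eq_mul, hsdef, hd]
      field_simp
      ring
    simp only [map_add, LinearMap.add_apply, map_smul, LinearMap.smul_apply, smul_eq_mul] at h5 h9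
    linarith
  have hsum := Finset.sum_le_sum fun n hn => hrow n (Finset.mem_range.1 hn)
  simp only [Finset.sum_add_distrib, Finset.sum_sub_distrib, ← Finset.sum_div,
    ← Finset.mul_sum, ← Finset.sum_mul] at hsum
  simp only [← Finset.sum_sub_distrib, Finset.sum_range_sub
    (fun n => a (W n) (W n)), Finset.sum_range_sub (l1Energy g p W),
    Finset.sum_range_sub (l2Energy g q d)] at hsum
  have hE1 := l1Energy_nonneg hg hp hpa W j
  have hE10 : l1Energy g p W 0 = 0 := by simp [l1Energy]
  have hE20 : l2Energy g q d 0 = 0 := by simp [l2Energy]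
  have hE2 : q (j - 1) * ∑ n ∈ Finset.range j, g (d n) (d n) ≤ l2Energy g q d j := by
    rw [Finset.mul_sum]
    exact Finset.sum_le_sum fun n hn => mul_le_mul_of_nonneg_right (hqa (by omega)) (hg _)
  have hQj : (∑ n ∈ Finset.range j, q n) * g y y ≤ Q * g y y :=
    mul_le_mul_of_nonneg_right (Finset.sum_le_sum_of_subset_of_nonneg
      (Finset.range_mono hjm) fun i _ _ => hqn i) (hg _)
  have hs0 : s 0 ≤ 1 / 2 := by
    simp only [hsdef]
    rw [div_le_div_iff₀ hσ0 two_pos]; linarith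
  -- Young with parameter `1 / 2` bounds each of `a (W 1) (W n)` and `-a (W 1) (W 0)` by `a (W 1) (W
  -- 1) + X / 4`. Since `s 0 ≤ 1 / 2`, the whole sum costs only one such quantity.
  have hAbel := sum_antitone_mul_sub_le (s := s) (z := fun n => a (W 1) (W n - W 0))
    (Z := 2 * (a (W 1) (W 1) + X / 4)) (m := j) (fun n => div_nonneg (hqn n) hσ0.le)
    (fun n k hnk => div_le_div_of_nonneg_right (hqa hnk) hσ0.le) (by simp) fun n hn => by
      have h1 := form_le_young as ha (by norm_num : (0 : ℝ) < 1 / 2) (W 1) (W n)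
      have h2 := form_le_young as ha (by norm_num : (0 : ℝ) < 1 / 2) (-W 1) (W 0)
      have h3 := hmax n (by simp; omega)
      have h4 := hmax 0 (by simp)
      simp only [map_sub, map_neg, LinearMap.neg_apply, neg_neg] at h1 h2 h3 h4 ⊢
      linarith
  have hZ : s 0 * (2 * (a (W 1) (W 1) + X / 4)) ≤ a (W 1) (W 1) + X / 4 := by
    have : 0 ≤ a (W 1) (W 1) + X / 4 := by have := ha (W 1); have := ha (W j); positivity
    nlinarith
  have hF : (∑ n ∈ Finset.range j, g (F n) (F n)) / (2 * q (j - 1))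
      ≤ 2 / q (m - 1) * (∑ n ∈ Finset.range m, g (F n) (F n)) / 4 := by
    have h1 : ∑ n ∈ Finset.range j, g (F n) (F n) ≤ ∑ n ∈ Finset.range m, g (F n) (F n) :=
      Finset.sum_le_sum_of_subset_of_nonneg (Finset.range_mono hjm) fun i _ _ => hg _
    have h0 : 0 ≤ ∑ n ∈ Finset.range j, g (F n) (F n) := Finset.sum_nonneg fun i _ => hg _
    have h2 := div_le_div₀ (h0.trans h1) h1 (mul_pos two_pos (hq (m - 1)))
      (mul_le_mul_of_nonneg_left hqj zero_le_two)
    have e : 2 / q (m - 1) * (∑ n ∈ Finset.range m, g (F n) (F n)) / 4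
      = (∑ n ∈ Finset.range m, g (F n) (F n)) / (2 * q (m - 1)) := by
      have := (hq (m - 1)).ne'
      field_simp; ring
    rw [e]; exact h2
  have hQy : Q * g y y ≤ 8 * (Q * τ ^ 2) * g ψ ψ + Q / q 0 ^ 2 * g (F 0) (F 0) / 2 := by
    have := mul_le_mul_of_nonneg_left hyy (hq0.le.trans hQ0)
    have e : Q * (8 * τ ^ 2 * g ψ ψ + g (F 0) (F 0) / (2 * q 0 ^ 2))
      = 8 * (Q * τ ^ 2) * g ψ ψ + Q / q 0 ^ 2 * g (F 0) (F 0) / 2 := by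
      field_simp
    linarith
  have hq1 : q 0 * τ ^ 2 * g ψ ψ ≤ Q * τ ^ 2 * g ψ ψ :=
    mul_le_mul_of_nonneg_right (mul_le_mul_of_nonneg_right hQ0 (sq_nonneg _)) (hg _)
  have hq2 : g (F 0) (F 0) / q 0 ≤ Q / q 0 ^ 2 * g (F 0) (F 0) := by
    have e : g (F 0) (F 0) / q 0 = q 0 / q 0 ^ 2 * g (F 0) (F 0) := by field_simp
    rw [e]
    exact mul_le_mul_of_nonneg_right (div_le_div_of_nonneg_right hQ0 (sq_nonneg _)) (hg _)
  have hq3 : g (F 0) (F 0) / (2 * q 0) = g (F 0) (F 0) / q 0 / 2 := by field_simp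
  have hXm : a (W m) (W m) ≤ X := hmax m (by simp)
  -- A term `X / 4` remains on the left. Multiplied by `4`, the initial energy has coefficient `2`
  -- directly and `4` through `a (W 1) (W 1)`; `ψ` collects `16 + 8` and `F 0` collects `1 + 2`.
  linarith

end Energy

/-! ### Positivity, monotonicity, convexity and size of the kernel coefficients. -/

section Coefficients

variable {s : ℝ}

/-- Arithmetic-geometric mean for the two powers, followed by `x (x + 2) ≤ (x + 1)²` and a
nonpositive exponent. -/
lemma two_mul_rpow_midpoint_le {r x : ℝ} (hr : r ≤ 0) (hx : 0 < x) :
    2 * (x + 1) ^ r ≤ (x + 2) ^ r + x ^ r := by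
  have e : ∀ z : ℝ, 0 < z → z ^ r = (z ^ (r / 2)) ^ 2 := fun z hz => by
    rw [← Real.rpow_natCast, ← Real.rpow_mul hz.le]; norm_num
  have h1 : ((x + 1) ^ 2) ^ (r / 2) ≤ ((x + 2) * x) ^ (r / 2) :=
    Real.rpow_le_rpow_of_nonpos (by positivity) (by nlinarith) (by linarith)
  rw [Real.mul_rpow (by linarith) hx.le, ← Real.rpow_natCast, ← Real.rpow_mul (by linarith)] at h1
  rw [show ((2 : ℕ) : ℝ) * (r / 2) = r by push_cast; ring] at h1
  rw [e x hx, e (x + 2) (by linarith)]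
  nlinarith [sq_nonneg ((x + 2) ^ (r / 2) - x ^ (r / 2))]

/-- Convexity of the coefficients is a sign of a third difference of `x ^ s`. The derivative here is
`-s` times a second difference of the convex function `x ^ (s - 1)`. -/
lemma two_mul_add_one_rpow_sub_antitone (hs₀ : 0 < s) (hs₁ : s < 1) :
    AntitoneOn (fun x : ℝ => 2 * (x + 1) ^ s - (x + 2) ^ s - x ^ s) (Set.Ici 0) := by
  have hd : ∀ x ∈ interior (Set.Ici (0 : ℝ)),
      HasDerivAt (fun x : ℝ => 2 * (x + 1) ^ s - (x + 2) ^ s - x ^ s)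
        (2 * (s * (x + 1) ^ (s - 1)) - s * (x + 2) ^ (s - 1) - s * x ^ (s - 1)) x := by
    intro x hx
    rw [interior_Ici, Set.mem_Ioi] at hx
    have h1 := ((hasDerivAt_id x).add_const 1).rpow_const (p := s) (Or.inl (by simp; linarith))
    have h2 := ((hasDerivAt_id x).add_const 2).rpow_const (p := s) (Or.inl (by simp; linarith))
    have h3 := (hasDerivAt_id x).rpow_const (p := s) (Or.inl (by simp; linarith))
    refine (((h1.const_mul 2).sub h2).sub h3).congr_deriv ?_
    simp
  refine antitoneOn_of_deriv_nonpos (convex_Ici 0) ?_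
    (fun x hx => (hd x hx).differentiableAt.differentiableWithinAt) fun x hx => ?_
  · refine Continuous.continuousOn ?_
    have := Real.continuous_rpow_const hs₀.le
    fun_prop
  · rw [(hd x hx).deriv]
    rw [interior_Ici, Set.mem_Ioi] at hx
    have h := two_mul_rpow_midpoint_le (by linarith : s - 1 ≤ 0) hx
    nlinarith

lemma rpow_second_difference_nonpos (hs₀ : 0 < s) (hs₁ : s < 1) {x : ℝ} (hx : 0 ≤ x) :
    (x + 2) ^ s - (x + 1) ^ s ≤ (x + 1) ^ s - x ^ s := by
  have h := (Real.concaveOn_rpow hs₀.le hs₁.le).2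
      (Set.mem_Ici.2 hx) (Set.mem_Ici.2 (by linarith : 0 ≤ x + 2))
      (by norm_num : (0 : ℝ) ≤ 1 / 2) (by norm_num : (0 : ℝ) ≤ 1 / 2) (by norm_num)
  simp only [smul_eq_mul] at h
  rw [show 1 / 2 * x + 1 / 2 * (x + 2) = x + 1 by ring] at h
  linarith

variable {α : ℝ}

lemma gamma_two_sub_pos (hα₁ : α < 1) : 0 < Real.Gamma (2 - α) :=
  Real.Gamma_pos_of_pos (by linarith)

lemma aCoeff_pos (hα₁ : α < 1) (n : ℕ) : 0 < aCoeff α n := by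
  refine div_pos (sub_pos.2 ?_) (gamma_two_sub_pos hα₁)
  exact Real.rpow_lt_rpow (Nat.cast_nonneg n) (by linarith) (by linarith)

lemma aCoeff_antitone (hα₀ : 0 < α) (hα₁ : α < 1) : Antitone (aCoeff α) := by
  refine antitone_nat_of_succ_le fun n => ?_
  refine div_le_div_of_nonneg_right ?_ (gamma_two_sub_pos hα₁).le
  have := rpow_second_difference_nonpos (by linarith : 0 < 1 - α) (by linarith)
    (Nat.cast_nonneg (α := ℝ) n)
  push_cast
  rwa [add_assoc, one_add_one_eq_two]

lemma aCoeff_convex (hα₀ : 0 < α) (hα₁ : α < 1) (n : ℕ) :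
    aCoeff α (n + 1) - aCoeff α (n + 2) ≤ aCoeff α n - aCoeff α (n + 1) := by
  have h := two_mul_add_one_rpow_sub_antitone (by linarith : 0 < 1 - α) (by linarith)
    (Set.mem_Ici.2 (Nat.cast_nonneg (α := ℝ) n))
    (Set.mem_Ici.2 (by positivity : 0 ≤ (n : ℝ) + 1)) (by linarith)
  simp only [aCoeff, ← sub_div]
  refine div_le_div_of_nonneg_right ?_ (gamma_two_sub_pos hα₁).le
  push_cast
  simp only [add_assoc] at h ⊢
  norm_num at h ⊢
  linarith

lemma aCoeff_zero (hα₁ : α < 1) : aCoeff α 0 = 1 / Real.Gamma (2 - α) := by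
  simp [aCoeff, Real.zero_rpow (by linarith : 1 - α ≠ 0)]

lemma sum_aCoeff (hα₁ : α < 1) (m : ℕ) :
    ∑ n ∈ Finset.range m, aCoeff α n = (m : ℝ) ^ (1 - α) / Real.Gamma (2 - α) := by
  have h := Finset.sum_range_sub (fun n : ℕ => (n : ℝ) ^ (1 - α)) m
  simp only [Nat.cast_zero, Real.zero_rpow (by linarith : 1 - α ≠ 0), sub_zero] at h
  rw [← h, Finset.sum_div]
  simp [aCoeff]

/-- Bernoulli's inequality for `(1 - 1 / (n + 1)) ^ (1 - α)`, multiplied by `(n + 1) ^ (1 - α)`. -/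
lemma le_aCoeff (hα₀ : 0 < α) (hα₁ : α < 1) (n : ℕ) :
    (1 - α) * ((n : ℝ) + 1) ^ (-α) / Real.Gamma (2 - α) ≤ aCoeff α n := by
  refine div_le_div_of_nonneg_right ?_ (gamma_two_sub_pos hα₁).le
  have hn : (0 : ℝ) < n + 1 := by positivity
  have h := rpow_one_add_le_one_add_mul_self (s := -1 / ((n : ℝ) + 1)) (p := 1 - α)
    (by rw [le_div_iff₀ hn]; linarith [Nat.cast_nonneg (α := ℝ) n]) (by linarith) (by linarith)
  have h1 := mul_le_mul_of_nonneg_left h (Real.rpow_nonneg hn.le (1 - α))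
  have e : (1 : ℝ) + -1 / (n + 1) = n / (n + 1) := by field_simp; ring
  rw [e, ← Real.mul_rpow hn.le (by positivity), mul_div_cancel₀ _ hn.ne'] at h1
  have e2 : ((n : ℝ) + 1) ^ (1 - α) = ((n : ℝ) + 1) ^ (-α) * (n + 1) := by
    rw [sub_eq_neg_add, Real.rpow_add_one hn.ne']
  have e3 : ((n : ℝ) + 1) ^ (1 - α) * (1 + (1 - α) * (-1 / (n + 1)))
    = ((n : ℝ) + 1) ^ (1 - α) - (1 - α) * ((n : ℝ) + 1) ^ (-α) := by
    rw [e2]; field_simp; ring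
  linarith

end Coefficients

/-! ### The energy estimate with constants uniform in the time step. -/

section Estimate

variable {E : Type*} [AddCommGroup E] [Module ℝ E]

/-- A stability constant of the scheme for forms in general position. -/
noncomputable def stabConst (K₂ β T : ℝ) : ℝ :=
  6 + 24 * (K₂ * T ^ (2 - β) / Real.Gamma (3 - β)) + 3 * (T * Real.Gamma (3 - β) / K₂)
    + 2 * (T ^ (β - 1) * Real.Gamma (3 - β) / ((2 - β) * K₂))

lemma one_le_stabConst {K₂ β T : ℝ} (hK₂ : 0 < K₂) (hβ₂ : β < 2) (hT : 0 < T) :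
    1 ≤ stabConst K₂ β T := by
  have h1 : 0 < Real.Gamma (3 - β) := Real.Gamma_pos_of_pos (by linarith)
  have h2 : 0 < 2 - β := by linarith
  have : 0 ≤ 24 * (K₂ * T ^ (2 - β) / Real.Gamma (3 - β)) + 3 * (T * Real.Gamma (3 - β) / K₂)
    + 2 * (T ^ (β - 1) * Real.Gamma (3 - β) / ((2 - β) * K₂)) := by positivity
  unfold stabConst; linarith

theorem scheme_energy_estimate {g a : LinearMap.BilinForm ℝ E}
    (hs : ∀ x y, g x y = g y x) (hg : ∀ x, 0 ≤ g x x)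
    (as : ∀ x y, a x y = a y x) (ha : ∀ x, 0 ≤ a x x)
    {K₁ K₂ α β T τ : ℝ} (hK₁ : 0 < K₁) (hK₂ : 0 < K₂) (hα₀ : 0 < α) (hα₁ : α < 1)
    (hβ₁ : 1 < β) (hβ₂ : β < 2) (hτ : 0 < τ) {W F : ℕ → E} {ψ : E} {m : ℕ}
    (hm : 0 < m) (hmT : m * τ ≤ T)
    (heq : ∀ n < m, ∀ v, g (l1Conv (fun k => K₁ / τ ^ α * aCoeff α k) W n
        + l2Conv (fun k => K₂ / τ ^ β * bCoeff β k) W n) v + a (W (n + 1)) v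
      = g (F n + (2 * (K₂ / τ ^ β * bCoeff β n) * τ) • ψ) v) :
    a (W m) (W m) ≤ stabConst K₂ β T * (a (W 0) (W 0) + (g ψ ψ + τ ^ (β - 1) * g (F 0) (F 0)
      + τ * ∑ n ∈ Finset.range m, g (F n) (F n))) := by
  have hΓ : 0 < Real.Gamma (3 - β) := Real.Gamma_pos_of_pos (by linarith)
  have hb2 : 0 < 2 - β := by linarith
  have hT : 0 < T := lt_of_lt_of_le (by positivity) hmT
  have hτT : τ ≤ T := le_trans (by
    have : (1 : ℝ) ≤ m := by exact_mod_cast hm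
    nlinarith) hmT
  have ep : (2 - (β - 1)) = 3 - β := by ring
  have ep' : (1 - (β - 1)) = 2 - β := by ring
  have hκ : 0 < K₂ / τ ^ β := by positivity
  have hκ1 : 0 < K₁ / τ ^ α := by positivity
  have h := energy_estimate hs hg as ha (fun n => (mul_pos hκ1 (aCoeff_pos hα₁ n)).le)
    (fun i j hij => mul_le_mul_of_nonneg_left (aCoeff_antitone hα₀ hα₁ hij) hκ1.le)
    (fun n => by
      have := mul_le_mul_of_nonneg_left (aCoeff_convex hα₀ hα₁ n) hκ1.le
      linarith)
    (fun n => mul_pos hκ (aCoeff_pos (by linarith : β - 1 < 1) n))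
    (fun i j hij => mul_le_mul_of_nonneg_left
      (aCoeff_antitone (by linarith : 0 < β - 1) (by linarith) hij) hκ.le) hm heq
  have hQ : ∑ n ∈ Finset.range m, K₂ / τ ^ β * bCoeff β n
      = K₂ / τ ^ β * ((m : ℝ) ^ (2 - β) / Real.Gamma (3 - β)) := by
    rw [← Finset.mul_sum]
    simp only [bCoeff]
    rw [sum_aCoeff (by linarith), ep, ep']
  have hq0 : bCoeff β 0 = 1 / Real.Gamma (3 - β) := by
    rw [bCoeff, aCoeff_zero (by linarith), ep]
  have hmτ : (m : ℝ) ^ (2 - β) * τ ^ (2 - β) ≤ T ^ (2 - β) := by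
    rw [← Real.mul_rpow (by positivity) hτ.le]
    exact Real.rpow_le_rpow (by positivity) hmT hb2.le
  have hmτ' : (m : ℝ) ^ (β - 1) * τ ^ (β - 1) ≤ T ^ (β - 1) := by
    rw [← Real.mul_rpow (by positivity) hτ.le]
    exact Real.rpow_le_rpow (by positivity) hmT (by linarith)
  have hτ2 : τ ^ (2 - β) * τ ^ β = τ ^ 2 := by
    rw [← Real.rpow_add hτ, ← Real.rpow_natCast]; norm_num
  have hτ1 : τ ^ (β - 1) * τ = τ ^ β := by
    rw [← Real.rpow_add_one hτ.ne']; norm_num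
  have hτβ : 0 < τ ^ β := by positivity
  have c1 : (∑ n ∈ Finset.range m, K₂ / τ ^ β * bCoeff β n) * τ ^ 2
      ≤ K₂ * T ^ (2 - β) / Real.Gamma (3 - β) := by
    rw [hQ, ← hτ2]
    have e : K₂ / τ ^ β * ((m : ℝ) ^ (2 - β) / Real.Gamma (3 - β)) * (τ ^ (2 - β) * τ ^ β)
      = K₂ * ((m : ℝ) ^ (2 - β) * τ ^ (2 - β)) / Real.Gamma (3 - β) := by field_simp
    rw [e]; gcongr
  -- The quotient is a constant times `m ^ (2 - β) * τ ^ β`. The bound `m τ ≤ T` uses up `τ ^ (2 -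
  -- β)`, one factor `τ ^ (β - 1)` is bounded by `T ^ (β - 1)`, and the other is the weight of the
  -- first source term.
  have c2 : (∑ n ∈ Finset.range m, K₂ / τ ^ β * bCoeff β n) / (K₂ / τ ^ β * bCoeff β 0) ^ 2
      ≤ T * Real.Gamma (3 - β) / K₂ * τ ^ (β - 1) := by
    rw [hQ, hq0]
    have e : K₂ / τ ^ β * ((m : ℝ) ^ (2 - β) / Real.Gamma (3 - β))
        / (K₂ / τ ^ β * (1 / Real.Gamma (3 - β))) ^ 2
      = (m : ℝ) ^ (2 - β) * τ ^ β * Real.Gamma (3 - β) / K₂ := by field_simp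
    rw [e]
    have e1 : τ ^ β = τ ^ (2 - β) * τ ^ (β - 1) * τ ^ (β - 1) := by
      rw [← Real.rpow_add hτ, ← Real.rpow_add hτ]; congr 1; ring
    have e2 : T = T ^ (2 - β) * T ^ (β - 1) := by
      rw [← Real.rpow_add hT]; norm_num
    have e3 : (m : ℝ) ^ (2 - β) * τ ^ β ≤ T * τ ^ (β - 1) := by
      have e4 : τ ^ (β - 1) ≤ T ^ (β - 1) := Real.rpow_le_rpow hτ.le hτT (by linarith)
      calc (m : ℝ) ^ (2 - β) * τ ^ β
          = (m : ℝ) ^ (2 - β) * τ ^ (2 - β) * τ ^ (β - 1) * τ ^ (β - 1) := by rw [e1]; ring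
        _ ≤ T ^ (2 - β) * T ^ (β - 1) * τ ^ (β - 1) := by gcongr
        _ = T * τ ^ (β - 1) := by rw [← e2]
    calc (m : ℝ) ^ (2 - β) * τ ^ β * Real.Gamma (3 - β) / K₂
        ≤ T * τ ^ (β - 1) * Real.Gamma (3 - β) / K₂ := by gcongr
      _ = _ := by ring
  -- The lower bound for the last coefficient makes this `O(τ)`, which turns the sum of sources into
  -- a Riemann sum.
  have c3 : 2 / (K₂ / τ ^ β * bCoeff β (m - 1))
      ≤ 2 * (T ^ (β - 1) * Real.Gamma (3 - β) / ((2 - β) * K₂)) * τ := by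
    have hb := le_aCoeff (by linarith : 0 < β - 1) (by linarith) (m - 1)
    have hm1 : ((m - 1 : ℕ) : ℝ) + 1 = m := by exact_mod_cast Nat.sub_add_cancel hm
    have hm0 : (0 : ℝ) < m := by exact_mod_cast hm
    rw [ep, ep', hm1, Real.rpow_neg hm0.le] at hb
    have h1 : 0 < (2 - β) * ((m : ℝ) ^ (β - 1))⁻¹ / Real.Gamma (3 - β) := by positivity
    calc 2 / (K₂ / τ ^ β * bCoeff β (m - 1))
        ≤ 2 / (K₂ / τ ^ β * ((2 - β) * ((m : ℝ) ^ (β - 1))⁻¹ / Real.Gamma (3 - β))) := by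
          refine div_le_div_of_nonneg_left zero_le_two (by positivity) ?_
          exact mul_le_mul_of_nonneg_left hb hκ.le
      _ = 2 * ((m : ℝ) ^ (β - 1) * τ ^ (β - 1) * Real.Gamma (3 - β) / ((2 - β) * K₂)) * τ := by
          rw [← hτ1]; field_simp
      _ ≤ _ := by gcongr
  have hS : 0 ≤ ∑ n ∈ Finset.range m, g (F n) (F n) := Finset.sum_nonneg fun _ _ => hg _
  have d1 := mul_le_mul_of_nonneg_right c1 (hg ψ)
  have d2 := mul_le_mul_of_nonneg_right c2 (hg (F 0))
  have d3 := mul_le_mul_of_nonneg_right c3 hS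
  set A₁ := K₂ * T ^ (2 - β) / Real.Gamma (3 - β) with hA₁
  set A₂ := T * Real.Gamma (3 - β) / K₂ with hA₂
  set A₃ := T ^ (β - 1) * Real.Gamma (3 - β) / ((2 - β) * K₂) with hA₃
  have p1 : 0 ≤ A₁ := by positivity
  have p2 : 0 ≤ A₂ := by positivity
  have p3 : 0 ≤ A₃ := by positivity
  have hC : stabConst K₂ β T = 6 + 24 * A₁ + 3 * A₂ + 2 * A₃ := rfl
  have q1 : 6 * a (W 0) (W 0) ≤ stabConst K₂ β T * a (W 0) (W 0) :=
    mul_le_mul_of_nonneg_right (by linarith) (ha _)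
  have q2 : 24 * A₁ * g ψ ψ ≤ stabConst K₂ β T * g ψ ψ :=
    mul_le_mul_of_nonneg_right (by linarith) (hg _)
  have q3 : 3 * A₂ * (τ ^ (β - 1) * g (F 0) (F 0))
      ≤ stabConst K₂ β T * (τ ^ (β - 1) * g (F 0) (F 0)) :=
    mul_le_mul_of_nonneg_right (by linarith) (mul_nonneg (by positivity) (hg _))
  have q4 : 2 * A₃ * (τ * ∑ n ∈ Finset.range m, g (F n) (F n))
      ≤ stabConst K₂ β T * (τ * ∑ n ∈ Finset.range m, g (F n) (F n)) :=
    mul_le_mul_of_nonneg_right (by linarith) (mul_nonneg hτ.le hS)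
  have hb : ∀ n, aCoeff (β - 1) n = bCoeff β n := fun _ => rfl
  simp only [hb] at h
  simp only [mul_add]
  linarith

end Estimate

/-! ### Discrete Laplacian, compact average and the operators relating them. -/

section Space

/-- Extension by zero of a function on the `m` interior grid points. -/
def extZero (m : ℕ) : (Fin m → ℝ) →ₗ[ℝ] (ℕ → ℝ) where
  toFun e i := if h : 1 ≤ i ∧ i ≤ m then e ⟨i - 1, by omega⟩ else 0
  map_add' e f := by ext i; by_cases h : 1 ≤ i ∧ i ≤ m <;> simp [h]
  map_smul' c e := by ext i; by_cases h : 1 ≤ i ∧ i ≤ m <;> simp [h]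

/-- Restriction of a grid function to the `m` interior grid points. -/
def resInt (m : ℕ) : (ℕ → ℝ) →ₗ[ℝ] (Fin m → ℝ) where
  toFun u j := u (j + 1)
  map_add' _ _ := rfl
  map_smul' _ _ := rfl

/-- The compact average of a grid function at the interior grid points. -/
noncomputable def avgInt (m : ℕ) : (ℕ → ℝ) →ₗ[ℝ] (Fin m → ℝ) where
  toFun u j := (u j + 10 * u (j + 1) + u (j + 2)) / 12
  map_add' u v := by ext j; simp; ring
  map_smul' c u := by ext j; simp; ring

/-- The negative second difference quotient of a grid function at the interior grid points. -/
noncomputable def negLaplInt (h : ℝ) (m : ℕ) : (ℕ → ℝ) →ₗ[ℝ] (Fin m → ℝ) where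
  toFun u j := -((u (j + 2) - 2 * u (j + 1) + u j) / h ^ 2)
  map_add' u v := by ext j; simp; ring
  map_smul' c u := by ext j; simp; ring

/-- The negative Dirichlet Laplacian on the interior grid points. -/
noncomputable def negLapl (h : ℝ) (m : ℕ) : (Fin m → ℝ) →ₗ[ℝ] (Fin m → ℝ) :=
  negLaplInt h m ∘ₗ extZero m

/-- The compact average with zero boundary values. -/
noncomputable def avgZero (m : ℕ) : (Fin m → ℝ) →ₗ[ℝ] (Fin m → ℝ) :=
  avgInt m ∘ₗ extZero m

variable {m : ℕ} {h : ℝ}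

lemma extZero_zero (e : Fin m → ℝ) : extZero m e 0 = 0 := by simp [extZero]

lemma extZero_last (e : Fin m → ℝ) : extZero m e (m + 1) = 0 := by simp [extZero]

lemma extZero_succ (e : Fin m → ℝ) (j : Fin m) : extZero m e (j + 1) = e j := by
  simp [extZero, Nat.succ_le_iff]

lemma extZero_resInt {u : ℕ → ℝ} (h0 : u 0 = 0) (h1 : u (m + 1) = 0) {i : ℕ}
    (hi : i ≤ m + 1) : extZero m (resInt m u) i = u i := by
  rcases Nat.eq_zero_or_pos i with rfl | hi0
  · rw [extZero_zero, h0]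
  rcases hi.eq_or_lt with rfl | hlt
  · rw [extZero_last, h1]
  · obtain ⟨j, rfl⟩ : ∃ j, i = j + 1 := ⟨i - 1, by omega⟩
    exact extZero_succ (resInt m u) ⟨j, by omega⟩

lemma avgZero_resInt {u : ℕ → ℝ} (h0 : u 0 = 0) (h1 : u (m + 1) = 0) :
    avgZero m (resInt m u) = avgInt m u := by
  ext j
  simp only [avgZero, avgInt, LinearMap.comp_apply, LinearMap.coe_mk, AddHom.coe_mk]
  rw [extZero_resInt h0 h1, extZero_resInt h0 h1, extZero_resInt h0 h1] <;> omega

lemma negLapl_resInt {u : ℕ → ℝ} (h0 : u 0 = 0) (h1 : u (m + 1) = 0) :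
    negLapl h m (resInt m u) = negLaplInt h m u := by
  ext j
  simp only [negLapl, negLaplInt, LinearMap.comp_apply, LinearMap.coe_mk, AddHom.coe_mk]
  rw [extZero_resInt h0 h1, extZero_resInt h0 h1, extZero_resInt h0 h1] <;> omega

lemma avgZero_eq (hh : h ≠ 0) (e : Fin m → ℝ) :
    avgZero m e = e - (h ^ 2 / 12) • negLapl h m e := by
  ext j
  simp only [avgZero, avgInt, negLapl, negLaplInt, LinearMap.comp_apply, LinearMap.coe_mk,
    AddHom.coe_mk, Pi.sub_apply, Pi.smul_apply, smul_eq_mul]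
  conv_rhs => enter [1]; rw [← extZero_succ e j]
  field_simp
  ring

lemma sum_by_parts (U V : ℕ → ℝ) (m : ℕ) :
    ∑ i ∈ Finset.range m, -(U (i + 2) - 2 * U (i + 1) + U i) * V (i + 1)
      + (U (m + 1) - U m) * V (m + 1) - (U 1 - U 0) * V 0
    = ∑ i ∈ Finset.range (m + 1), (U (i + 1) - U i) * (V (i + 1) - V i) := by
  induction m with
  | zero => simp; ring
  | succ m ih => rw [Finset.sum_range_succ, Finset.sum_range_succ _ (m + 1), ← ih]; ring

/-- The Dirichlet form of the discrete Laplacian. -/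
lemma negLapl_dotProduct (e f : Fin m → ℝ) :
    negLapl h m e ⬝ᵥ f = (∑ i ∈ Finset.range (m + 1),
      (extZero m e (i + 1) - extZero m e i) * (extZero m f (i + 1) - extZero m f i)) / h ^ 2 := by
  rw [← sum_by_parts, extZero_last f, extZero_zero f, mul_zero, mul_zero, add_zero, sub_zero,
    Finset.sum_div, ← Fin.sum_univ_eq_sum_range (fun i =>
      -(extZero m e (i + 2) - 2 * extZero m e (i + 1) + extZero m e i) * extZero m f (i + 1)
        / h ^ 2)]
  refine Finset.sum_congr rfl fun j _ => ?_
  rw [extZero_succ f]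
  simp only [negLapl, negLaplInt, LinearMap.comp_apply, LinearMap.coe_mk, AddHom.coe_mk]
  ring

lemma negLapl_symm (e f : Fin m → ℝ) : negLapl h m e ⬝ᵥ f = negLapl h m f ⬝ᵥ e := by
  simp only [negLapl_dotProduct, mul_comm]

lemma negLapl_self (e : Fin m → ℝ) :
    negLapl h m e ⬝ᵥ e
      = (∑ i ∈ Finset.range (m + 1), (extZero m e (i + 1) - extZero m e i) ^ 2) / h ^ 2 := by
  simp only [negLapl_dotProduct, sq]

lemma negLapl_nonneg (e : Fin m → ℝ) : 0 ≤ negLapl h m e ⬝ᵥ e := by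
  rw [negLapl_self]; positivity

lemma dotProduct_self_nonneg_real (e : Fin m → ℝ) : 0 ≤ e ⬝ᵥ e :=
  Finset.sum_nonneg fun _ _ => mul_self_nonneg _

/-- The inverse inequality for the discrete Laplacian. -/
lemma negLapl_sq_le (hh : 0 < h) (e : Fin m → ℝ) :
    negLapl h m e ⬝ᵥ negLapl h m e ≤ 4 / h ^ 2 * (negLapl h m e ⬝ᵥ e) := by
  set D : ℕ → ℝ := fun i => extZero m e (i + 1) - extZero m e i with hD
  have h1 : negLapl h m e ⬝ᵥ negLapl h m e
      = (∑ i ∈ Finset.range m, (D (i + 1) - D i) ^ 2) / h ^ 4 := by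
    rw [Finset.sum_div, ← Fin.sum_univ_eq_sum_range (fun i => (D (i + 1) - D i) ^ 2 / h ^ 4)]
    refine Finset.sum_congr rfl fun j _ => ?_
    simp only [negLapl, negLaplInt, LinearMap.comp_apply, LinearMap.coe_mk, AddHom.coe_mk, hD]
    field_simp
    ring
  have h2 : ∑ i ∈ Finset.range m, (D (i + 1) - D i) ^ 2
      ≤ ∑ i ∈ Finset.range m, (2 * D (i + 1) ^ 2 + 2 * D i ^ 2) :=
    Finset.sum_le_sum fun i _ => by nlinarith [sq_nonneg (D (i + 1) + D i)]
  have h3 := Finset.sum_range_succ (fun i => D i ^ 2) m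
  have h4 := Finset.sum_range_succ' (fun i => D i ^ 2) m
  rw [Finset.sum_add_distrib, ← Finset.mul_sum, ← Finset.mul_sum] at h2
  have h5 : ∑ i ∈ Finset.range m, (D (i + 1) - D i) ^ 2
      ≤ 4 * ∑ i ∈ Finset.range (m + 1), D i ^ 2 := by
    nlinarith [sq_nonneg (D m), sq_nonneg (D 0)]
  rw [h1, negLapl_self]
  calc (∑ i ∈ Finset.range m, (D (i + 1) - D i) ^ 2) / h ^ 4
      ≤ (4 * ∑ i ∈ Finset.range (m + 1), D i ^ 2) / h ^ 4 := by gcongr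
    _ = _ := by field_simp; rfl

lemma sq_le_mul_sum_sq_sub {U : ℕ → ℝ} (h0 : U 0 = 0) {i n : ℕ} (hi : i ≤ n) :
    U i ^ 2 ≤ n * ∑ k ∈ Finset.range n, (U (k + 1) - U k) ^ 2 := by
  have h1 : U i = ∑ k ∈ Finset.range i, (U (k + 1) - U k) := by
    rw [Finset.sum_range_sub, h0, sub_zero]
  have h2 : ∑ k ∈ Finset.range i, (U (k + 1) - U k) ^ 2
      ≤ ∑ k ∈ Finset.range n, (U (k + 1) - U k) ^ 2 :=
    Finset.sum_le_sum_of_subset_of_nonneg (Finset.range_mono hi) fun _ _ _ => sq_nonneg _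
  have h3 := sq_sum_le_card_mul_sum_sq (s := Finset.range i) (f := fun k => U (k + 1) - U k)
  rw [← h1, Finset.card_range] at h3
  refine h3.trans (mul_le_mul (by exact_mod_cast hi) h2 (Finset.sum_nonneg fun _ _ => sq_nonneg _)
    (by positivity))

/-- The discrete Poincaré inequality. -/
lemma dotProduct_self_le_negLapl (hh : 0 < h) (e : Fin m → ℝ) :
    e ⬝ᵥ e ≤ (((m + 1 : ℕ) : ℝ) * h) ^ 2 * (negLapl h m e ⬝ᵥ e) := by
  set S := ∑ k ∈ Finset.range (m + 1), (extZero m e (k + 1) - extZero m e k) ^ 2 with hS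
  have hS0 : 0 ≤ S := Finset.sum_nonneg fun _ _ => sq_nonneg _
  have h1 : ∀ j ∈ (Finset.univ : Finset (Fin m)), e j * e j ≤ ((m + 1 : ℕ) : ℝ) * S := by
    intro j _
    rw [← extZero_succ e j, ← sq]
    exact sq_le_mul_sum_sq_sub (extZero_zero e) (by omega)
  have h2 := Finset.sum_le_card_nsmul _ _ _ h1
  rw [Finset.card_univ, Fintype.card_fin, nsmul_eq_mul] at h2
  refine le_trans h2 ?_
  rw [negLapl_self, ← hS]
  have e1 : (((m + 1 : ℕ) : ℝ) * h) ^ 2 * (S / h ^ 2)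
    = ((m + 1 : ℕ) : ℝ) * (((m + 1 : ℕ) : ℝ) * S) := by field_simp
  rw [e1]
  exact mul_le_mul_of_nonneg_right (by push_cast; linarith) (by positivity)

/-- Expanding `‖e - (h² / 4) Λ e‖² ≥ 0` and inserting `negLapl_sq_le` gives the bound without
eigenvalues. -/
lemma negLapl_le (hh : 0 < h) (e : Fin m → ℝ) :
    negLapl h m e ⬝ᵥ e ≤ 4 / h ^ 2 * (e ⬝ᵥ e) := by
  have h1 := dotProduct_self_nonneg_real (e - (h ^ 2 / 4) • negLapl h m e)
  simp only [sub_dotProduct, dotProduct_sub, smul_dotProduct, dotProduct_smul, smul_eq_mul] at h1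
  rw [dotProduct_comm e (negLapl h m e)] at h1
  have h2 := mul_le_mul_of_nonneg_left (negLapl_sq_le hh e) (by positivity : 0 ≤ h ^ 2 / 4)
  have e1 : h ^ 2 / 4 * (4 / h ^ 2 * (negLapl h m e ⬝ᵥ e)) = negLapl h m e ⬝ᵥ e := by
    field_simp
  rw [e1] at h2
  have h3 := mul_le_mul_of_nonneg_left h2 (by positivity : 0 ≤ h ^ 2 / 4)
  have h4 : h ^ 2 / 4 * (negLapl h m e ⬝ᵥ e) ≤ e ⬝ᵥ e := by linarith
  have h5 := mul_le_mul_of_nonneg_left h4 (by positivity : 0 ≤ 4 / h ^ 2)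
  have e2 : 4 / h ^ 2 * (h ^ 2 / 4 * (negLapl h m e ⬝ᵥ e)) = negLapl h m e ⬝ᵥ e := by
    field_simp
  linarith

lemma avgZero_coercive (hh : 0 < h) (e : Fin m → ℝ) : 2 / 3 * (e ⬝ᵥ e) ≤ avgZero m e ⬝ᵥ e := by
  rw [avgZero_eq hh.ne', sub_dotProduct, smul_dotProduct, smul_eq_mul]
  have h1 := mul_le_mul_of_nonneg_left (negLapl_le hh e) (by positivity : 0 ≤ h ^ 2 / 12)
  have e1 : h ^ 2 / 12 * (4 / h ^ 2 * (e ⬝ᵥ e)) = (e ⬝ᵥ e) / 3 := by field_simp; ring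
  linarith

lemma avgZero_symm (hh : 0 < h) (e f : Fin m → ℝ) : avgZero m e ⬝ᵥ f = avgZero m f ⬝ᵥ e := by
  simp only [avgZero_eq hh.ne', sub_dotProduct, smul_dotProduct]
  rw [negLapl_symm, dotProduct_comm e f]

lemma eq_zero_of_dotProduct_self_nonpos {e : Fin m → ℝ} (he : e ⬝ᵥ e ≤ 0) : e = 0 :=
  dotProduct_self_eq_zero.1 (le_antisymm he (dotProduct_self_nonneg_real e))

lemma avgZero_injective : Function.Injective (avgZero m) := by
  rw [injective_iff_map_eq_zero]
  intro e he
  -- The average does not depend on the mesh width, so `h = 1` may be used.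
  have h1 := avgZero_coercive one_pos e
  rw [he, zero_dotProduct] at h1
  exact eq_zero_of_dotProduct_self_nonpos (by linarith)

lemma negLapl_injective (hh : 0 < h) : Function.Injective (negLapl h m) := by
  rw [injective_iff_map_eq_zero]
  intro e he
  have h1 := dotProduct_self_le_negLapl hh e
  rw [he, zero_dotProduct, mul_zero] at h1
  exact eq_zero_of_dotProduct_self_nonpos h1

/-- The interior grid function with zero boundary values that has the same compact average as a
given grid function. -/
noncomputable def avgRep (m : ℕ) : (ℕ → ℝ) →ₗ[ℝ] (Fin m → ℝ) :=
  (LinearEquiv.ofInjectiveEndo (avgZero m) avgZero_injective).symm.toLinearMap ∘ₗ avgInt m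

lemma avgZero_avgRep (u : ℕ → ℝ) : avgZero m (avgRep m u) = avgInt m u :=
  (LinearEquiv.ofInjectiveEndo (avgZero m) avgZero_injective).apply_symm_apply _

lemma avgRep_eq_resInt {u : ℕ → ℝ} (h0 : u 0 = 0) (h1 : u (m + 1) = 0) :
    avgRep m u = resInt m u :=
  avgZero_injective (by rw [avgZero_avgRep, avgZero_resInt h0 h1])

lemma avgInt_sq_le (u : ℕ → ℝ) :
    avgInt m u ⬝ᵥ avgInt m u ≤ ∑ i ∈ Finset.range (m + 2), u i ^ 2 := by
  have h1 : avgInt m u ⬝ᵥ avgInt m u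
      = ∑ i ∈ Finset.range m, ((u i + 10 * u (i + 1) + u (i + 2)) / 12) ^ 2 := by
    rw [← Fin.sum_univ_eq_sum_range (fun i => ((u i + 10 * u (i + 1) + u (i + 2)) / 12) ^ 2)]
    exact Finset.sum_congr rfl fun j _ => by simp [avgInt, sq]
  have h2 : ∑ i ∈ Finset.range m, ((u i + 10 * u (i + 1) + u (i + 2)) / 12) ^ 2
      ≤ ∑ i ∈ Finset.range m, (u i ^ 2 / 12 + 10 / 12 * u (i + 1) ^ 2 + u (i + 2) ^ 2 / 12) :=
    Finset.sum_le_sum fun i _ => by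
      nlinarith [sq_nonneg (u i - u (i + 1)), sq_nonneg (u i - u (i + 2)),
        sq_nonneg (u (i + 1) - u (i + 2))]
  rw [Finset.sum_add_distrib, Finset.sum_add_distrib, ← Finset.mul_sum, ← Finset.sum_div,
    ← Finset.sum_div] at h2
  have h3 := Finset.sum_range_succ' (fun i => u i ^ 2) (m + 1)
  have h4 := Finset.sum_range_succ' (fun i => u (i + 1) ^ 2) m
  have h5 := Finset.sum_range_succ (fun i => u i ^ 2) (m + 1)
  have h6 := Finset.sum_range_succ (fun i => u i ^ 2) m
  have h7 := Finset.sum_range_succ (fun i => u (i + 1) ^ 2) m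
  simp only [add_assoc, Nat.reduceAdd] at *
  nlinarith [sq_nonneg (u 0), sq_nonneg (u m), sq_nonneg (u 1), sq_nonneg (u (m + 1))]

/-- With `b` the average and `z` its representative, `‖b - (2/3) z‖² ≥ 0` and the coercivity `(2/3)
‖z‖² ≤ (b, z)` give `(b, z) ≤ (3/2) ‖b‖²`. -/
lemma avgZero_avgRep_le (u : ℕ → ℝ) :
    avgZero m (avgRep m u) ⬝ᵥ avgRep m u ≤ 3 / 2 * ∑ i ∈ Finset.range (m + 2), u i ^ 2 := by
  have h1 := avgZero_coercive one_pos (avgRep m u)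
  have h2 := dotProduct_self_nonneg_real (avgInt m u - (2 / 3 : ℝ) • avgRep m u)
  simp only [sub_dotProduct, dotProduct_sub, smul_dotProduct, dotProduct_smul, smul_eq_mul] at h2
  rw [dotProduct_comm (avgRep m u) (avgInt m u)] at h2
  rw [avgZero_avgRep] at h1 ⊢
  have h3 := avgInt_sq_le (m := m) u
  linarith

lemma avgRep_sq_le (u : ℕ → ℝ) :
    avgRep m u ⬝ᵥ avgRep m u ≤ 9 / 4 * ∑ i ∈ Finset.range (m + 2), u i ^ 2 := by
  have h1 := avgZero_coercive one_pos (avgRep m u)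
  have h2 := avgZero_avgRep_le (m := m) u
  linarith

/-- The bilinear form `h (G e, f)` on interior grid functions. -/
noncomputable def gridForm (h : ℝ) (G : (Fin m → ℝ) →ₗ[ℝ] (Fin m → ℝ)) :
    LinearMap.BilinForm ℝ (Fin m → ℝ) :=
  LinearMap.mk₂ ℝ (fun e f => h * (G e ⬝ᵥ f))
    (fun _ _ _ => by simp [mul_add]) (fun _ _ _ => by simp; ring)
    (fun _ _ _ => by simp [mul_add]) (fun _ _ _ => by simp; ring)

lemma gridForm_apply (G : (Fin m → ℝ) →ₗ[ℝ] (Fin m → ℝ)) (e f : Fin m → ℝ) :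
    gridForm h G e f = h * (G e ⬝ᵥ f) := rfl

/-- The inverse of the Dirichlet Laplacian composed with the compact average. -/
noncomputable def invLaplAvg (hh : 0 < h) (m : ℕ) : (Fin m → ℝ) →ₗ[ℝ] (Fin m → ℝ) :=
  (LinearEquiv.ofInjectiveEndo (negLapl h m) (negLapl_injective hh)).symm.toLinearMap ∘ₗ avgZero m

lemma exists_negLapl_eq (hh : 0 < h) (e : Fin m → ℝ) : ∃ f, negLapl h m f = e :=
  (LinearEquiv.ofInjectiveEndo (negLapl h m) (negLapl_injective hh)).surjective e

lemma invLaplAvg_negLapl (hh : 0 < h) (e : Fin m → ℝ) :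
    invLaplAvg hh m (negLapl h m e) = e - (h ^ 2 / 12) • negLapl h m e := by
  apply negLapl_injective hh
  have h1 : negLapl h m (invLaplAvg hh m (negLapl h m e)) = avgZero m (negLapl h m e) :=
    (LinearEquiv.ofInjectiveEndo (negLapl h m) (negLapl_injective hh)).apply_symm_apply _
  rw [h1, avgZero_eq hh.ne', map_sub, map_smul]

lemma invLaplAvg_symm (hh : 0 < h) (e f : Fin m → ℝ) :
    invLaplAvg hh m e ⬝ᵥ f = invLaplAvg hh m f ⬝ᵥ e := by
  obtain ⟨e, rfl⟩ := exists_negLapl_eq hh e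
  obtain ⟨f, rfl⟩ := exists_negLapl_eq hh f
  simp only [invLaplAvg_negLapl, sub_dotProduct, smul_dotProduct]
  rw [dotProduct_comm e, dotProduct_comm f, negLapl_symm,
    dotProduct_comm (negLapl h m e) (negLapl h m f)]

/-- Writing the argument as `Λ e` turns the form into `(Λ e, e) - (h² / 12) ‖Λ e‖²`, and the inverse
inequality limits the loss to a third of the first term. -/
lemma invLaplAvg_nonneg (hh : 0 < h) (e : Fin m → ℝ) : 0 ≤ invLaplAvg hh m e ⬝ᵥ e := by
  obtain ⟨e, rfl⟩ := exists_negLapl_eq hh e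
  simp only [invLaplAvg_negLapl, sub_dotProduct, smul_dotProduct, smul_eq_mul]
  rw [dotProduct_comm e]
  have h1 := mul_le_mul_of_nonneg_left (negLapl_sq_le hh e) (by positivity : 0 ≤ h ^ 2 / 12)
  have e1 : h ^ 2 / 12 * (4 / h ^ 2 * (negLapl h m e ⬝ᵥ e)) = (negLapl h m e ⬝ᵥ e) / 3 := by
    field_simp; ring
  have := negLapl_nonneg (h := h) e
  linarith

/-- After the same substitution, the claim reduces to `(Λ e, e) ≤ P ‖Λ e‖²`, obtained from Poincaré
and `‖e - P Λ e‖² ≥ 0`. -/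
lemma invLaplAvg_le (hh : 0 < h) (e : Fin m → ℝ) :
    invLaplAvg hh m e ⬝ᵥ e ≤ (((m + 1 : ℕ) : ℝ) * h) ^ 2 * (e ⬝ᵥ e) := by
  obtain ⟨e, rfl⟩ := exists_negLapl_eq hh e
  simp only [invLaplAvg_negLapl, sub_dotProduct, smul_dotProduct, smul_eq_mul]
  rw [dotProduct_comm e]
  set P := (((m + 1 : ℕ) : ℝ) * h) ^ 2 with hP
  have hP0 : 0 < P := by positivity
  have h1 := dotProduct_self_le_negLapl hh e
  rw [← hP] at h1
  have h2 := dotProduct_self_nonneg_real (e - P • negLapl h m e)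
  simp only [sub_dotProduct, dotProduct_sub, smul_dotProduct, dotProduct_smul, smul_eq_mul] at h2
  rw [dotProduct_comm e (negLapl h m e)] at h2
  have h3 := dotProduct_self_nonneg_real (negLapl h m e)
  have h4 : 0 ≤ h ^ 2 / 12 * (negLapl h m e ⬝ᵥ negLapl h m e) := by positivity
  have h5 : P * (negLapl h m e ⬝ᵥ e) ≤ P * (P * (negLapl h m e ⬝ᵥ negLapl h m e)) := by linarith
  have h6 := le_of_mul_le_mul_left h5 hP0
  linarith

end Space

/-! ### Translation of the pointwise scheme and norms into the abstract setting. -/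

section Scheme

variable {E E' : Type*} [AddCommGroup E] [Module ℝ E] [AddCommGroup E'] [Module ℝ E']

lemma map_l1Conv (A : E →ₗ[ℝ] E') (p : ℕ → ℝ) (W : ℕ → E) (n : ℕ) :
    A (l1Conv p W n) = l1Conv p (fun k => A (W k)) n := by
  simp [l1Conv, map_sub, map_sum]

lemma map_l2Conv (A : E →ₗ[ℝ] E') (q : ℕ → ℝ) (W : ℕ → E) (n : ℕ) :
    A (l2Conv q W n) = l2Conv q (fun k => A (W k)) n := by
  simp [l2Conv, map_sub, map_sum]

lemma l1Conv_sub (p : ℕ → ℝ) (U V : ℕ → E) (n : ℕ) :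
    l1Conv p (fun k => U k - V k) n = l1Conv p U n - l1Conv p V n := by
  simp only [l1Conv, smul_sub, Finset.sum_sub_distrib]; abel

lemma l2Conv_sub (q : ℕ → ℝ) (U V : ℕ → E) (n : ℕ) :
    l2Conv q (fun k => U k - V k) n = l2Conv q U n - l2Conv q V n := by
  simp only [l2Conv, smul_sub, Finset.sum_sub_distrib]; abel

lemma l1Conv_eq_deltaAlpha (K τ α : ℝ) (u : ℕ → ℝ) (n : ℕ) :
    l1Conv (fun k => K / τ ^ α * aCoeff α k) u n = K * deltaAlpha τ α u (n + 1) := by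
  have h1 : ∑ k ∈ Finset.Icc 1 n, (aCoeff α (n + 1 - k - 1) - aCoeff α (n + 1 - k)) * u k
      = ∑ k ∈ Finset.range n, (aCoeff α (n - 1 - k) - aCoeff α (n - k)) * u (k + 1) := by
    rw [← Finset.Ico_add_one_right_eq_Icc, Finset.sum_Ico_eq_sum_range]
    refine Finset.sum_congr rfl fun k _ => ?_
    rw [show n + 1 - (1 + k) - 1 = n - 1 - k by omega, show n + 1 - (1 + k) = n - k by omega,
      add_comm 1 k]
  simp only [l1Conv, deltaAlpha, Nat.add_sub_cancel, h1, smul_eq_mul, ← mul_sub, mul_assoc,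
    ← Finset.mul_sum]
  ring

lemma l2Conv_eq_DeltaBeta (K τ β : ℝ) (u : ℕ → ℝ) (n : ℕ) :
    l2Conv (fun k => K / τ ^ β * bCoeff β k) u n = K * DeltaBeta τ β u (n + 1) := by
  have h1 : ∑ k ∈ Finset.Icc 2 (n + 1), bCoeff β (n + 1 - k) * (u k - 2 * u (k - 1) + u (k - 2))
      = ∑ k ∈ Finset.range n,
          bCoeff β (n - 1 - k) * ((u (k + 2) - u (k + 1)) - (u (k + 1) - u k)) := by
    rw [← Finset.Ico_add_one_right_eq_Icc, Finset.sum_Ico_eq_sum_range]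
    refine Finset.sum_congr rfl fun k _ => ?_
    rw [show n + 1 - (2 + k) = n - 1 - k by omega, show 2 + k - 1 = k + 1 by omega,
      show 2 + k - 2 = k by omega, add_comm 2 k]
    ring
  have h2 : ∑ k ∈ Finset.range n, bCoeff β (n - 1 - k) * (u (k + 2) - u (k + 1))
      = ∑ k ∈ Finset.range n, bCoeff β (n - k) * (u (k + 1) - u k)
        + bCoeff β 0 * (u (n + 1) - u n) - bCoeff β n * (u 1 - u 0) := by
    have e1 := Finset.sum_range_succ (fun k => bCoeff β (n - k) * (u (k + 1) - u k)) n
    have e2 := Finset.sum_range_succ' (fun k => bCoeff β (n - k) * (u (k + 1) - u k)) n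
    simp only [Nat.sub_self, Nat.sub_zero, zero_add] at e1 e2
    have e3 : ∑ k ∈ Finset.range n, bCoeff β (n - 1 - k) * (u (k + 2) - u (k + 1))
        = ∑ k ∈ Finset.range n, bCoeff β (n - (k + 1)) * (u (k + 1 + 1) - u (k + 1)) :=
      Finset.sum_congr rfl fun k _ => by rw [show n - 1 - k = n - (k + 1) by omega]
    rw [e3]; linarith
  have h3 : ∑ k ∈ Finset.range n, (K / τ ^ β * bCoeff β (n - 1 - k) - K / τ ^ β * bCoeff β (n - k))
        * (u (k + 1) - u k)
      = K / τ ^ β * (∑ k ∈ Finset.range n, bCoeff β (n - 1 - k) * (u (k + 1) - u k)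
        - ∑ k ∈ Finset.range n, bCoeff β (n - k) * (u (k + 1) - u k)) := by
    rw [← Finset.sum_sub_distrib, Finset.mul_sum]
    exact Finset.sum_congr rfl fun k _ => by ring
  simp only [l2Conv, DeltaBeta, Nat.add_sub_cancel, h1, smul_eq_mul, h3]
  simp only [mul_sub (bCoeff β (n - 1 - _)) (u (_ + 2) - u (_ + 1)), Finset.sum_sub_distrib, h2]
  ring

/-- The scheme as an equation between interior grid functions. -/
lemma IsSchemeSolution.vector_eq {K₁ K₂ α β L T : ℝ} {m N : ℕ} {φ₀ φ₁ g₀ g₁ : ℝ → ℝ}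
    {f : ℝ → ℝ → ℝ} {u : ℕ → ℕ → ℝ} (hT : 0 < T)
    (hu : IsSchemeSolution K₁ K₂ α β L T (m + 1) N φ₀ φ₁ g₀ g₁ f u) {n : ℕ} (hn : n < N) :
    avgInt m (l1Conv (fun k => K₁ / (T / N) ^ α * aCoeff α k) (fun k i => u i k) n
        + l2Conv (fun k => K₂ / (T / N) ^ β * bCoeff β k) (fun k i => u i k) n
        - (fun i : ℕ => f (i * (L / (m + 1 : ℕ))) ((n + 1 : ℕ) * (T / N)))
        - (2 * (K₂ / (T / N) ^ β * bCoeff β n) * (T / N)) •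
            (fun i : ℕ => φ₁ (i * (L / (m + 1 : ℕ)))))
      + negLaplInt (L / (m + 1 : ℕ)) m (fun i => u i (n + 1)) = 0 := by
  have hτ : 0 < T / N := div_pos hT (by exact_mod_cast (by omega : 0 < N))
  have hb : 2 * (K₂ / (T / N) ^ β * bCoeff β n) * (T / N)
      = 2 * K₂ * bCoeff β n / (T / N) ^ (β - 1) := by
    rw [Real.rpow_sub_one hτ.ne']; field_simp
  have h1 : ∀ i, l1Conv (fun k => K₁ / (T / N) ^ α * aCoeff α k) (fun k i => u i k) n i
      = K₁ * deltaAlpha (T / N) α (u i) (n + 1) := fun i => by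
    rw [← l1Conv_eq_deltaAlpha]
    simp [l1Conv, Finset.sum_apply]
  have h2 : ∀ i, l2Conv (fun k => K₂ / (T / N) ^ β * bCoeff β k) (fun k i => u i k) n i
      = K₂ * DeltaBeta (T / N) β (u i) (n + 1) := fun i => by
    rw [← l2Conv_eq_DeltaBeta]
    simp [l2Conv, Finset.sum_apply]
  ext j
  have h3 := hu.equation (j + 1) (n + 1) (by omega) (by omega) (by omega) (by omega)
  have hj : ¬ ((j : ℕ) + 1 = 0 ∨ (j : ℕ) + 1 = m + 1) := by omega
  simp only [avgX, if_neg hj, deltaXX, Nat.add_sub_cancel, ← hb] at h3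
  simp only [avgInt, negLaplInt, LinearMap.coe_mk, AddHom.coe_mk, Pi.add_apply, Pi.sub_apply,
    Pi.smul_apply, smul_eq_mul, h1, h2, Pi.zero_apply]
  rw [show (j : ℕ) + 1 + 1 = j + 2 from rfl] at h3
  linarith

lemma l2Norm_sq {h : ℝ} (hh : 0 < h) (M : ℕ) (v : ℕ → ℝ) :
    l2Norm h M v ^ 2 = h * ∑ i ∈ Finset.range (M + 1), v i ^ 2 :=
  Real.sq_sqrt (mul_nonneg hh.le (Finset.sum_nonneg fun _ _ => sq_nonneg _))

lemma h1Norm_sq {h : ℝ} (hh : 0 < h) (M : ℕ) (v : ℕ → ℝ) :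
    h1Norm h M v ^ 2 = h * ((∑ i ∈ Finset.range M, (v (i + 1) - v i) ^ 2) / h ^ 2) := by
  rw [h1Norm, Real.sq_sqrt (mul_nonneg hh.le (Finset.sum_nonneg fun _ _ => sq_nonneg _)),
    ← Finset.Ico_add_one_right_eq_Icc, Finset.sum_Ico_eq_sum_range, Finset.sum_div]
  congr 1
  refine Finset.sum_congr rfl fun i _ => ?_
  rw [div_pow, add_comm 1 i, Nat.add_sub_cancel]

lemma l2Norm_sq_eq_dotProduct {h : ℝ} (hh : 0 < h) {m : ℕ} {v : ℕ → ℝ} (h0 : v 0 = 0)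
    (h1 : v (m + 1) = 0) :
    l2Norm h (m + 1) v ^ 2 = h * (resInt m v ⬝ᵥ resInt m v) := by
  rw [l2Norm_sq hh, Finset.sum_range_succ, Finset.sum_range_succ', h0, h1]
  rw [← Fin.sum_univ_eq_sum_range (fun i => v (i + 1) ^ 2)]
  simp [dotProduct, resInt, sq]

lemma h1Norm_sq_eq_dotProduct {h : ℝ} (hh : 0 < h) {m : ℕ} {v : ℕ → ℝ} (h0 : v 0 = 0)
    (h1 : v (m + 1) = 0) :
    h1Norm h (m + 1) v ^ 2 = h * (negLapl h m (resInt m v) ⬝ᵥ resInt m v) := by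
  rw [h1Norm_sq hh, negLapl_self]
  congr 2
  refine Finset.sum_congr rfl fun i hi => ?_
  have := Finset.mem_range.1 hi
  rw [extZero_resInt h0 h1 (by omega), extZero_resInt h0 h1 (by omega)]

/-- The discrete Sobolev embedding. -/
lemma maxNorm_sq_le {h : ℝ} (hh : 0 < h) {M : ℕ} {v : ℕ → ℝ} (h0 : v 0 = 0) :
    maxNorm M v ^ 2 ≤ M * h * h1Norm h M v ^ 2 := by
  obtain ⟨i, hi, he⟩ := Finset.exists_mem_eq_sup' (Finset.nonempty_range_add_one (n := M))
    (fun i => |v i|)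
  rw [maxNorm, he, sq_abs, h1Norm_sq hh]
  have h1 := sq_le_mul_sum_sq_sub h0 (by have := Finset.mem_range.1 hi; omega : i ≤ M)
  refine h1.trans (le_of_eq ?_)
  field_simp

end Scheme

/-! ### The difference equation and its stability for a general operator `G`. -/

section Stability

variable {K₁ K₂ α β L T : ℝ} {m N : ℕ} {φ₀ φ₁ ψ₀ ψ₁ g₀ g₁ : ℝ → ℝ} {f₁ f₂ : ℝ → ℝ → ℝ}
  {u v : ℕ → ℕ → ℝ}

/-- The equation satisfied by the difference of two solutions. -/
lemma IsSchemeSolution.difference_eq (hT : 0 < T)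
    (hu : IsSchemeSolution K₁ K₂ α β L T (m + 1) N φ₀ φ₁ g₀ g₁ f₁ u)
    (hv : IsSchemeSolution K₁ K₂ α β L T (m + 1) N ψ₀ ψ₁ g₀ g₁ f₂ v) {n : ℕ} (hn : n < N) :
    avgZero m (l1Conv (fun k => K₁ / (T / N) ^ α * aCoeff α k)
          (fun k => avgRep m fun i => u i k - v i k) n
        + l2Conv (fun k => K₂ / (T / N) ^ β * bCoeff β k)
          (fun k => avgRep m fun i => u i k - v i k) n
        - (avgRep m (fun i : ℕ => (f₁ - f₂) (i * (L / (m + 1 : ℕ))) ((n + 1 : ℕ) * (T / N)))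
          + (2 * (K₂ / (T / N) ^ β * bCoeff β n) * (T / N)) •
            avgRep m (fun i : ℕ => (φ₁ - ψ₁) (i * (L / (m + 1 : ℕ))))))
      + negLapl (L / (m + 1 : ℕ)) m (avgRep m fun i => u i (n + 1) - v i (n + 1)) = 0 := by
  have h0 : u 0 (n + 1) - v 0 (n + 1) = 0 := by
    rw [hu.boundary_left _ (by omega) (by omega), hv.boundary_left _ (by omega) (by omega), sub_self]
  have h1 : u (m + 1) (n + 1) - v (m + 1) (n + 1) = 0 := by
    rw [hu.boundary_right _ (by omega) (by omega), hv.boundary_right _ (by omega) (by omega),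
      sub_self]
  have h2 := hu.vector_eq hT hn
  have h3 := hv.vector_eq hT hn
  have h4 := sub_eq_zero.2 (h2.trans h3.symm)
  rw [add_sub_add_comm, ← map_sub, ← map_sub] at h4
  rw [avgRep_eq_resInt (u := fun i => u i (n + 1) - v i (n + 1)) h0 h1,
    negLapl_resInt (u := fun i => u i (n + 1) - v i (n + 1)) h0 h1,
    ← map_l1Conv (avgRep m) _ (fun k i => u i k - v i k),
    ← map_l2Conv (avgRep m) _ (fun k i => u i k - v i k), ← map_smul, ← map_add, ← map_add,
    ← map_sub, avgZero_avgRep]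
  refine Eq.trans ?_ h4
  have e1 := l1Conv_sub (fun k => K₁ / (T / N) ^ α * aCoeff α k) (fun k i => u i k)
    (fun k i => v i k) n
  have e2 := l2Conv_sub (fun k => K₂ / (T / N) ^ β * bCoeff β k) (fun k i => u i k)
    (fun k i => v i k) n
  congr 2
  · change l1Conv _ (fun k => (fun i => u i k) - fun i => v i k) n
      + l2Conv _ (fun k => (fun i => u i k) - fun i => v i k) n - _ = _
    rw [e1, e2]
    ext i
    simp only [Pi.add_apply, Pi.sub_apply, Pi.smul_apply, smul_eq_mul]
    ring

/-- Stability in the norms of two compatible grid forms. -/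
lemma gridForm_stability (hK₁ : 0 < K₁) (hK₂ : 0 < K₂) (hα₀ : 0 < α) (hα₁ : α < 1)
    (hβ₁ : 1 < β) (hβ₂ : β < 2) (hL : 0 < L) (hT : 0 < T)
    (hu : IsSchemeSolution K₁ K₂ α β L T (m + 1) N φ₀ φ₁ g₀ g₁ f₁ u)
    (hv : IsSchemeSolution K₁ K₂ α β L T (m + 1) N ψ₀ ψ₁ g₀ g₁ f₂ v)
    {G A B : (Fin m → ℝ) →ₗ[ℝ] (Fin m → ℝ)} (hG : G ∘ₗ avgZero m = B)
    (hA : G ∘ₗ negLapl (L / (m + 1 : ℕ)) m = A)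
    (As : ∀ e f, A e ⬝ᵥ f = A f ⬝ᵥ e) (Ap : ∀ e, 0 ≤ A e ⬝ᵥ e)
    (Bs : ∀ e f, B e ⬝ᵥ f = B f ⬝ᵥ e) (Bp : ∀ e, 0 ≤ B e ⬝ᵥ e) {c : ℝ} (hc : 1 ≤ c)
    (hB : ∀ w : ℕ → ℝ, B (avgRep m w) ⬝ᵥ avgRep m w ≤ c * ∑ i ∈ Finset.range (m + 2), w i ^ 2)
    {j : ℕ} (hj : 0 < j) (hjN : j ≤ N) :
    L / (m + 1 : ℕ) * (A (avgRep m fun i => u i j - v i j) ⬝ᵥ avgRep m fun i => u i j - v i j)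
      ≤ c * stabConst K₂ β T * (L / (m + 1 : ℕ) *
          (A (avgRep m fun i => u i 0 - v i 0) ⬝ᵥ avgRep m fun i => u i 0 - v i 0)
        + dataSize β L T (m + 1) N (φ₁ - ψ₁) (f₁ - f₂) j) := by
  have hG' : ∀ e, G (avgZero m e) = B e := LinearMap.congr_fun hG
  have hA' : ∀ e, G (negLapl (L / (m + 1 : ℕ)) m e) = A e := LinearMap.congr_fun hA
  have hh : 0 < L / (m + 1 : ℕ) := by positivity
  have hN : 0 < N := by omega
  have hN' : (0 : ℝ) < N := by exact_mod_cast hN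
  have hτ : 0 < T / N := by positivity
  set h := L / (m + 1 : ℕ) with hdef
  have hjT : j * (T / N) ≤ T := by
    rw [mul_div_assoc', div_le_iff₀ hN', mul_comm]
    exact mul_le_mul_of_nonneg_left (by exact_mod_cast hjN) hT.le
  have key := scheme_energy_estimate (g := gridForm h B) (a := gridForm h A)
    (fun x y => by simp only [gridForm_apply]; rw [Bs])
    (fun x => mul_nonneg hh.le (Bp x)) (fun x y => by simp only [gridForm_apply]; rw [As])
    (fun x => mul_nonneg hh.le (Ap x)) hK₁ hK₂ hα₀ hα₁ hβ₁ hβ₂ hτ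
    (W := fun k => avgRep m fun i => u i k - v i k)
    (F := fun n => avgRep m fun i : ℕ => (f₁ - f₂) (i * h) ((n + 1 : ℕ) * (T / N)))
    (ψ := avgRep m fun i : ℕ => (φ₁ - ψ₁) (i * h)) hj hjT (fun n hn e => by
      have h1 := congrArg (fun x => h * (G x ⬝ᵥ e)) (hu.difference_eq hT hv (hn.trans_le hjN))
      simp only [← hdef, map_add G, map_zero, zero_dotProduct, mul_zero, hG', hA'] at h1
      simp only [map_add, map_sub, add_dotProduct, sub_dotProduct] at h1
      simp only [gridForm_apply]
      rw [map_add B, map_add B, add_dotProduct, add_dotProduct]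
      linarith)
  have hb : ∀ w : ℕ → ℝ, gridForm h B (avgRep m w) (avgRep m w) ≤ c * l2Norm h (m + 1) w ^ 2 :=
    fun w => by
      rw [gridForm_apply, l2Norm_sq hh]
      have := mul_le_mul_of_nonneg_left (hB w) hh.le
      linarith
  have hS0 : 0 ≤ stabConst K₂ β T := zero_le_one.trans (one_le_stabConst hK₂ hβ₂ hT)
  have hF : ∑ n ∈ Finset.range j, gridForm h B
      (avgRep m fun i : ℕ => (f₁ - f₂) (i * h) ((n + 1 : ℕ) * (T / N)))
      (avgRep m fun i : ℕ => (f₁ - f₂) (i * h) ((n + 1 : ℕ) * (T / N)))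
      ≤ c * ∑ n ∈ Finset.Icc 1 j,
        l2Norm h (m + 1) (fun i => (f₁ - f₂) (i * h) (n * (T / N))) ^ 2 := by
    rw [← Finset.Ico_add_one_right_eq_Icc, Finset.sum_Ico_eq_sum_range, Finset.mul_sum]
    refine Finset.sum_le_sum fun n _ => ?_
    rw [add_comm 1 n]
    exact hb _
  have hF0 := hb fun i : ℕ => (f₁ - f₂) (i * h) ((0 + 1 : ℕ) * (T / N))
  have e0 : ((0 + 1 : ℕ) : ℝ) * (T / N) = T / N := by norm_num
  refine key.trans ?_
  rw [mul_comm c, mul_assoc]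
  refine mul_le_mul_of_nonneg_left ?_ hS0
  rw [mul_add]
  refine add_le_add (le_mul_of_one_le_left (mul_nonneg hh.le (Ap _)) hc) ?_
  have t1 := mul_le_mul_of_nonneg_left hF hτ.le
  have t2 := mul_le_mul_of_nonneg_left hF0 (Real.rpow_nonneg hτ.le (β - 1))
  have t3 := hb fun i : ℕ => (φ₁ - ψ₁) (i * h)
  rw [dataSize, ← hdef]
  simp only [e0] at t2 ⊢
  linarith

end Stability

/-! ### Stability in `L²` and `H¹`. -/

section Main

variable {K₁ K₂ α β L T : ℝ} {m N : ℕ} {φ₀ φ₁ ψ₀ ψ₁ g₀ g₁ : ℝ → ℝ} {f₁ f₂ : ℝ → ℝ → ℝ}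
  {u v : ℕ → ℕ → ℝ}

lemma IsSchemeSolution.difference_boundary
    (hu : IsSchemeSolution K₁ K₂ α β L T (m + 1) N φ₀ φ₁ g₀ g₁ f₁ u)
    (hv : IsSchemeSolution K₁ K₂ α β L T (m + 1) N ψ₀ ψ₁ g₀ g₁ f₂ v) {j : ℕ} (hj : 0 < j)
    (hjN : j ≤ N) : u 0 j - v 0 j = 0 ∧ u (m + 1) j - v (m + 1) j = 0 := by
  constructor
  · rw [hu.boundary_left _ hj hjN, hv.boundary_left _ hj hjN, sub_self]
  · rw [hu.boundary_right _ hj hjN, hv.boundary_right _ hj hjN, sub_self]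

lemma dataSize_nonneg (hT : 0 < T) (M : ℕ) (ψ : ℝ → ℝ) (F : ℝ → ℝ → ℝ) (j : ℕ) :
    0 ≤ dataSize β L T M N ψ F j := by
  unfold dataSize; positivity

theorem l2_stability (hK₁ : 0 < K₁) (hK₂ : 0 < K₂) (hα₀ : 0 < α) (hα₁ : α < 1)
    (hβ₁ : 1 < β) (hβ₂ : β < 2) (hL : 0 < L) (hT : 0 < T)
    (hu : IsSchemeSolution K₁ K₂ α β L T (m + 1) N φ₀ φ₁ g₀ g₁ f₁ u)
    (hv : IsSchemeSolution K₁ K₂ α β L T (m + 1) N ψ₀ ψ₁ g₀ g₁ f₂ v) {j : ℕ} (hjN : j ≤ N) :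
    l2Norm (L / (m + 1 : ℕ)) (m + 1) (fun i => u i j - v i j) ^ 2
      ≤ 6 * (1 + L ^ 2) * stabConst K₂ β T * (l2Norm (L / (m + 1 : ℕ)) (m + 1)
          (fun i => φ₀ (i * (L / (m + 1 : ℕ))) - ψ₀ (i * (L / (m + 1 : ℕ)))) ^ 2
        + dataSize β L T (m + 1) N (φ₁ - ψ₁) (f₁ - f₂) j) := by
  have hh : 0 < L / (m + 1 : ℕ) := by positivity
  have hR := dataSize_nonneg (β := β) (L := L) (N := N) hT (m + 1) (φ₁ - ψ₁) (f₁ - f₂) j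
  have hS := one_le_stabConst hK₂ hβ₂ hT
  have hinit : l2Norm (L / (m + 1 : ℕ)) (m + 1) (fun i => u i 0 - v i 0)
      = l2Norm (L / (m + 1 : ℕ)) (m + 1)
        (fun i => φ₀ (i * (L / (m + 1 : ℕ))) - ψ₀ (i * (L / (m + 1 : ℕ)))) := by
    unfold l2Norm
    congr 2
    refine Finset.sum_congr rfl fun i hi => ?_
    have := Finset.mem_range.1 hi
    beta_reduce
    rw [hu.initial i (by omega), hv.initial i (by omega)]
  rw [← hinit]
  set w₀ := l2Norm (L / (m + 1 : ℕ)) (m + 1) (fun i => u i 0 - v i 0) ^ 2 with hw₀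
  have hw0 : 0 ≤ w₀ := sq_nonneg _
  set S := stabConst K₂ β T
  set R := dataSize β L T (m + 1) N (φ₁ - ψ₁) (f₁ - f₂) j
  rcases Nat.eq_zero_or_pos j with rfl | hj
  · have h1 : 1 ≤ 6 * (1 + L ^ 2) * S := by nlinarith [sq_nonneg L]
    nlinarith
  obtain ⟨h0, h1⟩ := hu.difference_boundary hv hj hjN
  have hml : ((m + 1 : ℕ) : ℝ) * (L / (m + 1 : ℕ)) = L := by field_simp
  -- Here `G = Λ⁻¹`. The factor `9 / 4` comes from `avgRep_sq_le`, which is needed again for the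
  -- initial value, and `(9 / 4)² ≤ 6`.
  have key := gridForm_stability hK₁ hK₂ hα₀ hα₁ hβ₁ hβ₂ hL hT hu hv
    (G := (LinearEquiv.ofInjectiveEndo (negLapl (L / (m + 1 : ℕ)) m)
      (negLapl_injective hh)).symm.toLinearMap) (A := LinearMap.id) (B := invLaplAvg hh m) rfl
    (LinearMap.ext fun e => (LinearEquiv.ofInjectiveEndo (negLapl (L / (m + 1 : ℕ)) m)
      (negLapl_injective hh)).symm_apply_apply e)
    (fun e f => dotProduct_comm e f) dotProduct_self_nonneg_real (invLaplAvg_symm hh)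
    (invLaplAvg_nonneg hh) (c := 9 / 4 * (1 + L ^ 2)) (by nlinarith [sq_nonneg L]) (fun w => by
      have h2 := invLaplAvg_le hh (avgRep m w)
      rw [hml] at h2
      have h3 := avgRep_sq_le (m := m) w
      have h4 : 0 ≤ ∑ i ∈ Finset.range (m + 2), w i ^ 2 := Finset.sum_nonneg fun _ _ => sq_nonneg _
      nlinarith [mul_le_mul_of_nonneg_left h3 (sq_nonneg L)]) hj hjN
  rw [avgRep_eq_resInt h0 h1] at key
  rw [l2Norm_sq_eq_dotProduct hh h0 h1]
  have h5 := mul_le_mul_of_nonneg_left (avgRep_sq_le (m := m) fun i => u i 0 - v i 0) hh.le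
  have h6 : w₀ = _ := l2Norm_sq hh (m + 1) _
  refine key.trans ?_
  have h7 : L / (m + 1 : ℕ) * ((avgRep m fun i => u i 0 - v i 0) ⬝ᵥ
      avgRep m fun i => u i 0 - v i 0) ≤ 9 / 4 * w₀ := by rw [h6]; linarith
  have h8 : 0 ≤ (1 + L ^ 2) * S := by positivity
  simp only [LinearMap.id_apply]
  nlinarith [mul_le_mul_of_nonneg_left h7 h8, mul_nonneg h8 hw0, mul_nonneg h8 hR]

theorem h1_stability (hK₁ : 0 < K₁) (hK₂ : 0 < K₂) (hα₀ : 0 < α) (hα₁ : α < 1)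
    (hβ₁ : 1 < β) (hβ₂ : β < 2) (hL : 0 < L) (hT : 0 < T)
    (hu : IsSchemeSolution K₁ K₂ α β L T (m + 1) N φ₀ φ₁ g₀ g₁ f₁ u)
    (hv : IsSchemeSolution K₁ K₂ α β L T (m + 1) N ψ₀ ψ₁ g₀ g₁ f₂ v)
    (hb0 : u 0 0 - v 0 0 = 0) (hb1 : u (m + 1) 0 - v (m + 1) 0 = 0) {j : ℕ} (hjN : j ≤ N) :
    h1Norm (L / (m + 1 : ℕ)) (m + 1) (fun i => u i j - v i j) ^ 2
      ≤ 3 / 2 * stabConst K₂ β T * (h1Norm (L / (m + 1 : ℕ)) (m + 1)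
          (fun i => φ₀ (i * (L / (m + 1 : ℕ))) - ψ₀ (i * (L / (m + 1 : ℕ)))) ^ 2
        + dataSize β L T (m + 1) N (φ₁ - ψ₁) (f₁ - f₂) j) := by
  have hh : 0 < L / (m + 1 : ℕ) := by positivity
  have hS := one_le_stabConst hK₂ hβ₂ hT
  have hinit : h1Norm (L / (m + 1 : ℕ)) (m + 1) (fun i => u i 0 - v i 0)
      = h1Norm (L / (m + 1 : ℕ)) (m + 1)
        (fun i => φ₀ (i * (L / (m + 1 : ℕ))) - ψ₀ (i * (L / (m + 1 : ℕ)))) := by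
    unfold h1Norm
    congr 2
    refine Finset.sum_congr rfl fun i hi => ?_
    have := Finset.mem_Icc.1 hi
    beta_reduce
    rw [hu.initial i (by omega), hv.initial i (by omega), hu.initial (i - 1) (by omega),
      hv.initial (i - 1) (by omega)]
  rw [← hinit]
  rcases Nat.eq_zero_or_pos j with rfl | hj
  · have hR := dataSize_nonneg (β := β) (L := L) (N := N) hT (m + 1) (φ₁ - ψ₁) (f₁ - f₂) 0
    nlinarith [sq_nonneg (h1Norm (L / (m + 1 : ℕ)) (m + 1) (fun i => u i 0 - v i 0))]
  obtain ⟨h0, h1⟩ := hu.difference_boundary hv hj hjN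
  rw [h1Norm_sq_eq_dotProduct hh h0 h1, h1Norm_sq_eq_dotProduct hh hb0 hb1,
    ← avgRep_eq_resInt h0 h1, ← avgRep_eq_resInt hb0 hb1]
  exact gridForm_stability hK₁ hK₂ hα₀ hα₁ hβ₁ hβ₂ hL hT hu hv (G := LinearMap.id)
    (LinearMap.id_comp _) (LinearMap.id_comp _) negLapl_symm negLapl_nonneg (avgZero_symm hh)
    (fun e => le_trans (mul_nonneg (by norm_num) (dotProduct_self_nonneg_real e))
      (avgZero_coercive hh e)) (by norm_num) avgZero_avgRep_le hj hjN

end Main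
end MixedDiffusionWave

theorem mainTheorem4 (K₂ β L T : ℝ) (hK₂ : 0 < K₂) (hβ₁ : 1 < β) (hβ₂ : β < 2)
    (hL : 0 < L) (hT : 0 < T) :
    ∃ C : ℝ, 0 < C ∧
      ∀ (K₁ α : ℝ), 0 < K₁ → 0 < α → α < 1 →
      ∀ (M N : ℕ), 0 < M → 0 < N →
      ∀ (φ₀ φ₁ ψ₀ ψ₁ g₀ g₁ : ℝ → ℝ) (f₁ f₂ : ℝ → ℝ → ℝ) (u v : ℕ → ℕ → ℝ),
        MixedDiffusionWave.IsSchemeSolution K₁ K₂ α β L T M N φ₀ φ₁ g₀ g₁ f₁ u →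
        MixedDiffusionWave.IsSchemeSolution K₁ K₂ α β L T M N ψ₀ ψ₁ g₀ g₁ f₂ v →
        ∀ m : ℕ, m ≤ N →
          MixedDiffusionWave.l2Norm (L / M) M (fun i => u i m - v i m) ^ 2
            ≤ C * (MixedDiffusionWave.l2Norm (L / M) M
                    (fun i => φ₀ (i * (L / M)) - ψ₀ (i * (L / M))) ^ 2
                + MixedDiffusionWave.dataSize β L T M N (φ₁ - ψ₁) (f₁ - f₂) m) ∧
          (φ₀ 0 = ψ₀ 0 → φ₀ L = ψ₀ L →
            MixedDiffusionWave.h1Norm (L / M) M (fun i => u i m - v i m) ^ 2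
              ≤ C * (MixedDiffusionWave.h1Norm (L / M) M
                      (fun i => φ₀ (i * (L / M)) - ψ₀ (i * (L / M))) ^ 2
                  + MixedDiffusionWave.dataSize β L T M N (φ₁ - ψ₁) (f₁ - f₂) m) ∧
            MixedDiffusionWave.maxNorm M (fun i => u i m - v i m) ^ 2
              ≤ C * (MixedDiffusionWave.h1Norm (L / M) M
                      (fun i => φ₀ (i * (L / M)) - ψ₀ (i * (L / M))) ^ 2
                  + MixedDiffusionWave.dataSize β L T M N (φ₁ - ψ₁) (f₁ - f₂) m)) := by
  have hS : 0 < MixedDiffusionWave.stabConst K₂ β T :=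
    zero_lt_one.trans_le (MixedDiffusionWave.one_le_stabConst hK₂ hβ₂ hT)
  -- The term `L` serves the maximum norm, whose square is at most `L` times the squared `H¹`
  -- seminorm.
  refine ⟨6 * (1 + L + L ^ 2) * MixedDiffusionWave.stabConst K₂ β T, by positivity, ?_⟩
  intro K₁ α hK₁ hα₀ hα₁ M N hM hN φ₀ φ₁ ψ₀ ψ₁ g₀ g₁ f₁ f₂ u v hu hv j hj
  obtain ⟨m, rfl⟩ : ∃ m, M = m + 1 := ⟨M - 1, by omega⟩
  have hh : 0 < L / (m + 1 : ℕ) := by positivity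
  have hml : ((m + 1 : ℕ) : ℝ) * (L / (m + 1 : ℕ)) = L := by field_simp
  have hR := MixedDiffusionWave.dataSize_nonneg (β := β) (L := L) (N := N) hT (m + 1) (φ₁ - ψ₁)
    (f₁ - f₂) j
  set S := MixedDiffusionWave.stabConst K₂ β T
  refine ⟨?_, fun h0 hLL => ?_⟩
  · refine (MixedDiffusionWave.l2_stability hK₁ hK₂ hα₀ hα₁ hβ₁ hβ₂ hL hT hu hv hj).trans ?_
    gcongr
    linarith
  have hb0 : u 0 0 - v 0 0 = 0 := by
    rw [hu.initial 0 (by omega), hv.initial 0 (by omega)]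
    simp [h0]
  have hb1 : u (m + 1) 0 - v (m + 1) 0 = 0 := by
    rw [hu.initial (m + 1) le_rfl, hv.initial (m + 1) le_rfl, hml, hLL, sub_self]
  have hb : u 0 j - v 0 j = 0 := by
    rcases Nat.eq_zero_or_pos j with rfl | hj0
    · exact hb0
    · exact (hu.difference_boundary hv hj0 hj).1
  have h1 := MixedDiffusionWave.h1_stability hK₁ hK₂ hα₀ hα₁ hβ₁ hβ₂ hL hT hu hv hb0 hb1 hj
  have h2 := MixedDiffusionWave.maxNorm_sq_le hh (M := m + 1) (v := fun i => u i j - v i j) hb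
  rw [hml] at h2
  constructor
  · refine h1.trans ?_
    gcongr
    nlinarith [sq_nonneg L]
  · refine h2.trans ((mul_le_mul_of_nonneg_left h1 hL.le).trans ?_)
    rw [← mul_assoc, ← mul_assoc]
    refine mul_le_mul_of_nonneg_right (mul_le_mul_of_nonneg_right ?_ hS.le)
      (add_nonneg (sq_nonneg _) hR)
    nlinarith [sq_nonneg L]
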